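/- **Hypergraphs.** Let $Pr$ be a set with a rank function $rk:Pr\to\mathbb N$ (its elements are the primitive formulas). A hypergraph $G$ over a ranked set $\Sigma$ consists of a finite set of nodes $V_G$, a finite set of hyperedges $E_G$, a string $att_G(e)$ of attachment nodes and a label $lab_G(e)\in\Sigma$ with $rk(lab_G(e))=|att_G(e)|$ for each $e\in E_G$, and a string $ext_G$ of external nodes; $rk(G)=|ext_G|$. Hypergraphs are considered up to isomorphism. For distinct hyperedges $e_1,\dots,e_k$ of $G$ and hypergraphs $H_t$ with $rk(H_t)=|att_G(e_t)|$, $G[e_1/H_1,\dots,e_k/H_k]$ denotes the result of replacing each $e_t$ by $H_t$ (remove $e_t$, add $H_t$, and identify the $s$-th attachment node of $e_t$ with the $s$-th external node of $H_t$ for all $s$). The handle $a^\bullet$ has nodes $1,\dots,n$ ($n=rk(a)$) and one hyperedge labeled by $a$, whose attachment string and the string of external nodes are both $1\dots n$. **The hypergraph Lambek calculus $\mathrm{HL}$.** Let $\$_d$ ($d\in\mathbb N$, $rk(\$_d)=d$) be additional "hole" labels. Formulas of $\mathrm{HL}$: every $p\in Pr$; $\times(M)$ of rank $rk(M)$, for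 a hypergraph $M$ labeled by formulas; $N\div D$ of rank $d$, where $N$ is a formula, $D$ is a hypergraph with $rk(D)=rk(N)$, exactly one hyperedge $e^\$_D$ of $D$ is labeled by a hole label, this label is $\$_d$, and all other labels are formulas. Sequents are $H\to A$ where $A$ is a formula, $H$ is a hypergraph labeled by formulas, and $rk(H)=rk(A)$. The axioms are $A^\bullet\to A$. The rules are: * $(\times L)$: from $H[e/M]\to A$ infer $H[e/\times(M)^\bullet]\to A$; * $(\times R)$: from $H_t\to lab_M(m_t)$, $t=1,\dots,l$, infer $M[m_1/H_1,\dots,m_l/H_l]\to\times(M)$, where $E_M=\{m_1,\dots,m_l\}$; * $(\div L)$: from $H[e/N^\bullet]\to A$ and $H_t\to lab_D(d_t)$, $t=1,\dots,k$, infer $H\left[e/D[e^\$_D/(N\div D)^\bullet,d_1/H_1,\dots,d_k/H_k]\right]\to A$, where $E_D=\{e^\$_D,d_1,\dots,d_k\}$; * $(\div R)$: from $D[e^\$_D/F]\to N$ infer $F\to N\div D$. **The multimodal Lambek calculus $\mathrm{NL}_\Diamond$ without associative modes.** Let $I$ (modes) and $J$ (modalities) be disjoint subsets of $Pr$, and let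 $C\subseteq I$ (commutative modes), such that $rk(i)=3$ for $i\in I\setminus C$ and $rk(x)=2$ for $x\in C\cup J$. Formulas of $\mathrm{NL}_\Diamond$ are built from the elements of $Pr$ of rank 1 by $A\bullet_iB$, $B\backslash_iA$, $A/_iB$ ($i\in I$) and $\Diamond_jA$, $\square_jA$ ($j\in J$). Structured databases are formulas, $(\Pi_1,\Pi_2)^i$ and $\langle\Pi\rangle^j$, where $\Pi,\Pi_1,\Pi_2$ are structured databases, $i\in I$, $j\in J$; $\Delta[\cdot]$ denotes a structured database with one distinguished place. Sequents are $\Pi\to A$. The axioms are $A\to A$. The rules are: * from $\Delta[(A,B)^i]\to T$ infer $\Delta[A\bullet_iB]\to T$; from $\Pi_1\to A_1$ and $\Pi_2\to A_2$ infer $(\Pi_1,\Pi_2)^i\to A_1\bullet_iA_2$; * from $\Delta[A]\to T$ and $\Pi\to B$ infer $\Delta[(\Pi,B\backslash_iA)^i]\to T$ and infer $\Delta[(A/_iB,\Pi)^i]\to T$; * from $(B,\Pi)^i\to A$ infer $\Pi\to B\backslash_iA$; from $(\Pi,B)^i\to A$ infer $\Pi\to A/_iB$; * from $\Delta[\langle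 A\rangle^j]\to T$ infer $\Delta[\Diamond_jA]\to T$; from $\Pi\to A$ infer $\langle\Pi\rangle^j\to\Diamond_jA$; * from $\Delta[A]\to T$ infer $\Delta[\langle\square_jA\rangle^j]\to T$; from $\langle\Pi\rangle^j\to A$ infer $\Pi\to\square_jA$; * for $c\in C$: from $\Delta[(\Pi_1,\Pi_2)^c]\to T$ infer $\Delta[(\Pi_2,\Pi_1)^c]\to T$. **The translations.** All of the following hypergraphs have the single external node $v_1$. * $R^i(A,B)$: nodes $v_1,v_2,v_3$; hyperedges $r_0$ labeled $i$ and attached to $v_1v_2v_3$, $r_1$ labeled $A$ and attached to $v_2$, $r_2$ labeled $B$ and attached to $v_3$. * $K^c(A,B)$: nodes $v_1,v_2$; hyperedges $k_0$ labeled $c$ and attached to $v_1v_2$, and $k_1$ labeled $A$ and $k_2$ labeled $B$, both attached to $v_2$. * $U^j(A)$: nodes $v_1,v_2$; hyperedges $u_0$ labeled $j$ and attached to $v_1v_2$, and $u_1$ labeled $A$ and attached to $v_2$. For $p\in Pr$ of rank 1, $i\in I\setminus C$, $c\in C$, $j\in J$ put $\mu(p)=p$; $\mu(A\bullet_iB)=\times(R^i(\mu(A),\mu(B)))$;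 $\mu(B\backslash_iA)=\mu(A)\div R^i(\mu(B),\$_1)$; $\mu(A/_iB)=\mu(A)\div R^i(\$_1,\mu(B))$; $\mu(A\bullet_cB)=\times(K^c(\mu(A),\mu(B)))$; $\mu(B\backslash_cA)=\mu(A/_cB)=\mu(A)\div K^c(\mu(B),\$_1)$; $\mu(\Diamond_jA)=\times(U^j(\mu(A)))$; $\mu(\square_jA)=\mu(A)\div U^j(\$_1)$. For structured databases put $htree(A)=\mu(A)^\bullet$ for a formula $A$; $htree((\Pi_1,\Pi_2)^i)=R^i[r_1/htree(\Pi_1),r_2/htree(\Pi_2)]$; $htree((\Pi_1,\Pi_2)^c)=K^c[k_1/htree(\Pi_1),k_2/htree(\Pi_2)]$; $htree(\langle\Pi\rangle^j)=U^j[u_1/htree(\Pi)]$ (the labels of the replaced hyperedges are immaterial). **Theorem.** 1. For every structured database $\Pi$ and every formula $T$ of $\mathrm{NL}_\Diamond$, the sequent $\Pi\to T$ is derivable in $\mathrm{NL}_\Diamond$ if and only if $htree(\Pi)\to\mu(T)$ is derivable in $\mathrm{HL}$. 2. Let $G\to X$ be a sequent derivable in $\mathrm{HL}$ such that $X=\mu(A)$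 for some formula $A$ of $\mathrm{NL}_\Diamond$, and every label of $G$ either is of the form $\mu(B)$ for some formula $B$ of $\mathrm{NL}_\Diamond$ or belongs to $I\cup J$. Then there are a structured database $\Pi$ and a formula $T$ of $\mathrm{NL}_\Diamond$ such that $G=htree(\Pi)$, $X=\mu(T)$, and $\Pi\to T$ is derivable in $\mathrm{NL}_\Diamond$. -/

import Mathlib

universe u v

namespace HL

/-- A ranked set: a set together with a rank function. -/
class Ranked (L : Type u) where
  rk : L → ℕ

/-- A hypergraph over a ranked set `L` of labels: finitely many nodes and hyperedges, each hyperedge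
`e` having a string `att e` of attachment nodes and a label of rank `|att e|`, and a string `ext` of
external nodes. -/
structure Hypergraph (L : Type v) [Ranked L] where
  V : Type
  E : Type
  [finV : Finite V]
  [finE : Finite E]
  att : E → List V
  lab : E → L
  ext : List V
  rk_lab : ∀ e, Ranked.rk (lab e) = (att e).length

attribute [instance] Hypergraph.finV Hypergraph.finE

namespace Hypergraph

variable {L : Type v} [Ranked L]

/-- The rank of a hypergraph is the number of its external nodes. -/
instance : Ranked (Hypergraph L) := ⟨fun G => G.ext.length⟩

/-- Isomorphism of hypergraphs. -/
def Iso (G H : Hypergraph L) : Prop :=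
  ∃ (σ : G.V ≃ H.V) (τ : G.E ≃ H.E),
    (∀ e, H.att (τ e) = (G.att e).map σ) ∧ (∀ e, H.lab (τ e) = G.lab e) ∧ H.ext = G.ext.map σ

/-- The identifications made when the hyperedges `m i` of `G` are replaced by the `H i`: the `k`-th
attachment node of `m i` is identified with the `k`-th external node of `H i`. -/
def Glue (G : Hypergraph L) {ι : Type} (m : ι ↪ G.E) (H : ι → Hypergraph L)
    (x y : G.V ⊕ (Σ i, (H i).V)) : Prop :=
  ∃ (i : ι) (k : ℕ) (v : G.V) (w : (H i).V), (G.att (m i))[k]? = some v ∧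
    (H i).ext[k]? = some w ∧ x = Sum.inl v ∧ y = Sum.inr ⟨i, w⟩

/-- Simultaneous replacement `G[m i / H i, i ∈ ι]` of distinct hyperedges `m i` of `G` by the
hypergraphs `H i` (used only when the ranks of `m i` and `H i` agree). `Quot` is the quotient by the
smallest equivalence relation containing `Glue`. -/
def replace (G : Hypergraph L) {ι : Type} (m : ι ↪ G.E) (H : ι → Hypergraph L) :
    Hypergraph L where
  V := Quot (Glue G m H)
  E := {e : G.E // ∀ i, m i ≠ e} ⊕ (Σ i, (H i).E)
  finV := by
    have : Finite ι := Finite.of_injective m m.injective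
    infer_instance
  finE := by
    have : Finite ι := Finite.of_injective m m.injective
    infer_instance
  att := Sum.elim (fun e => (G.att e).map fun v => Quot.mk _ (Sum.inl v))
    (fun p => ((H p.1).att p.2).map fun w => Quot.mk _ (Sum.inr ⟨p.1, w⟩))
  lab := Sum.elim (fun e => G.lab e) (fun p => (H p.1).lab p.2)
  ext := G.ext.map fun v => Quot.mk _ (Sum.inl v)
  rk_lab := by
    rintro (e | p)
    · simpa using G.rk_lab e
    · simpa using (H p.1).rk_lab p.2

/-- Replacement `G[e / H]` of a single hyperedge. -/
def replaceOne (G : Hypergraph L) (e : G.E) (H : Hypergraph L) : Hypergraph L :=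
  G.replace (ι := Unit) ⟨fun _ => e, fun _ _ _ => rfl⟩ (fun _ => H)

/-- Replacement of all hyperedges of `G`. -/
def replaceAll (G : Hypergraph L) (H : G.E → Hypergraph L) : Hypergraph L :=
  G.replace (Function.Embedding.refl G.E) H

/-- The handle `a^•`: one hyperedge labeled by `a`, attached to `1, …, n`, with external nodes
`1, …, n`, where `n` is the rank of `a`. -/
def handle (a : L) : Hypergraph L where
  V := Fin (Ranked.rk a)
  E := Unit
  att _ := List.finRange _
  lab _ := a
  ext := List.finRange _
  rk_lab _ := by simp

end Hypergraph

/-- A hypergraph in which exactly one hyperedge is labeled by a hole label `$_d` instead of an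
element of `L`. Here `E` is the set of the other hyperedges, and `hole` is the string of attachment
nodes of the hole hyperedge, so `d = |hole|`. -/
structure HoleGraph (L : Type v) [Ranked L] where
  V : Type
  E : Type
  [finV : Finite V]
  [finE : Finite E]
  att : E → List V
  lab : E → L
  hole : List V
  ext : List V
  rk_lab : ∀ e, Ranked.rk (lab e) = (att e).length

attribute [instance] HoleGraph.finV HoleGraph.finE

/-- The hypergraph `D[e / a^•]`, `e` being the hole hyperedge of `D`: the hole label is replaced by
the label `a`. Its hyperedges are `none` (the former hole) and `some d` for `d ∈ D.E`. -/
def HoleGraph.fill {L : Type v} [Ranked L] (D : HoleGraph L) (a : L)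
    (ha : Ranked.rk a = D.hole.length) : Hypergraph L where
  V := D.V
  E := Option D.E
  att e := e.elim D.hole D.att
  lab e := e.elim a D.lab
  ext := D.ext
  rk_lab := by
    rintro (_ | e)
    · exact ha
    · exact D.rk_lab e

/-! ### Formulas

Hypergraphs are considered up to isomorphism, and so are the hypergraphs inside formulas. Hence the
formulas are the (rank-correct) formal expressions modulo isomorphism of the hypergraphs in them. -/

/-- Formal expressions `p`, `×(M)`, `N ÷ D`, without the rank conditions. -/
inductive PreFormula (Pr : Type u) : Type (max u 1)
  | prim (p : Pr) : PreFormula Pr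
  | times (V E : Type) [Finite V] [Finite E] (att : E → List V) (lab : E → PreFormula Pr)
      (ext : List V) : PreFormula Pr
  | div (N : PreFormula Pr) (V E : Type) [Finite V] [Finite E] (att : E → List V)
      (lab : E → PreFormula Pr) (hole ext : List V) : PreFormula Pr

namespace PreFormula

variable {Pr : Type u}

def rk [Ranked Pr] : PreFormula Pr → ℕ
  | prim p => Ranked.rk p
  | times _ _ _ _ ext => ext.length
  | div _ _ _ _ _ hole _ => hole.length

/-- The rank conditions in the definition of formulas. -/
def WF [Ranked Pr] : PreFormula Pr → Prop
  | prim _ => True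
  | times _ _ att lab _ => ∀ e, (lab e).WF ∧ (lab e).rk = (att e).length
  | div N _ _ att lab _ ext =>
      (N.WF ∧ N.rk = ext.length) ∧ ∀ e, (lab e).WF ∧ (lab e).rk = (att e).length

/-- Equality of formal expressions up to isomorphism of the hypergraphs in them. -/
inductive Equiv : PreFormula Pr → PreFormula Pr → Prop
  | prim (p : Pr) : Equiv (prim p) (prim p)
  | times {V E V' E' : Type} [Finite V] [Finite E] [Finite V'] [Finite E']
      {att : E → List V} {lab : E → PreFormula Pr} {ext : List V}
      {att' : E' → List V'} {lab' : E' → PreFormula Pr} {ext' : List V'}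
      (σ : V ≃ V') (τ : E ≃ E') (hatt : ∀ e, att' (τ e) = (att e).map σ)
      (hlab : ∀ e, Equiv (lab e) (lab' (τ e))) (hext : ext' = ext.map σ) :
      Equiv (times V E att lab ext) (times V' E' att' lab' ext')
  | div {N N' : PreFormula Pr} {V E V' E' : Type} [Finite V] [Finite E] [Finite V'] [Finite E']
      {att : E → List V} {lab : E → PreFormula Pr} {hole ext : List V}
      {att' : E' → List V'} {lab' : E' → PreFormula Pr} {hole' ext' : List V'}
      (hN : Equiv N N')
      (σ : V ≃ V') (τ : E ≃ E') (hatt : ∀ e, att' (τ e) = (att e).map σ)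
      (hlab : ∀ e, Equiv (lab e) (lab' (τ e))) (hhole : hole' = hole.map σ)
      (hext : ext' = ext.map σ) :
      Equiv (div N V E att lab hole ext) (div N' V' E' att' lab' hole' ext')

theorem Equiv.refl (A : PreFormula Pr) : Equiv A A := by
  induction A with
  | prim p => exact .prim p
  | times V E att lab ext ih =>
    exact .times (_root_.Equiv.refl V) (_root_.Equiv.refl E) (by simp) ih (by simp)
  | div N V E att lab hole ext ihN ih =>
    exact .div ihN (_root_.Equiv.refl V) (_root_.Equiv.refl E) (by simp) ih (by simp) (by simp)

theorem Equiv.symm {A B : PreFormula Pr} (h : Equiv A B) : Equiv B A := by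
  induction h with
  | prim p => exact .prim p
  | times σ τ hatt hlab hext ih =>
    refine .times σ.symm τ.symm (fun e => ?_) (fun e => ?_) ?_
    · have := hatt (τ.symm e)
      simp_all
    · simpa using ih (τ.symm e)
    · simp [hext]
  | div hN σ τ hatt hlab hhole hext ihN ih =>
    refine .div ihN σ.symm τ.symm (fun e => ?_) (fun e => ?_) ?_ ?_
    · have := hatt (τ.symm e)
      simp_all
    · simpa using ih (τ.symm e)
    · simp [hhole]
    · simp [hext]

theorem Equiv.trans {A B C : PreFormula Pr} (h : Equiv A B) (h' : Equiv B C) : Equiv A C := by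
  induction h generalizing C with
  | prim p => exact h'
  | times σ τ hatt hlab hext ih =>
    cases h' with
    | times σ' τ' hatt' hlab' hext' =>
      exact .times (σ.trans σ') (τ.trans τ') (fun e => by simp [hatt', hatt])
        (fun e => ih e (hlab' (τ e))) (by simp [hext', hext])
  | div hN σ τ hatt hlab hhole hext ihN ih =>
    cases h' with
    | div hN' σ' τ' hatt' hlab' hhole' hext' =>
      exact .div (ihN hN') (σ.trans σ') (τ.trans τ') (fun e => by simp [hatt', hatt])
        (fun e => ih e (hlab' (τ e))) (by simp [hhole', hhole]) (by simp [hext', hext])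

theorem Equiv.rk_eq [Ranked Pr] {A B : PreFormula Pr} (h : Equiv A B) : A.rk = B.rk := by
  cases h <;> simp_all [rk]

/-- Rank-correct formal expressions, compared up to isomorphism. -/
instance setoid (Pr : Type u) [Ranked Pr] : Setoid {A : PreFormula Pr // A.WF} where
  r A B := Equiv A.1 B.1
  iseqv := ⟨fun A => .refl A.1, fun h => h.symm, fun h h' => h.trans h'⟩

end PreFormula

/-- The set of formulas of the hypergraph Lambek calculus with primitive formulas `Pr`. -/
def Formula (Pr : Type u) [Ranked Pr] : Type (max u 1) := Quotient (PreFormula.setoid Pr)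

namespace Formula

variable {Pr : Type u} [Ranked Pr]

instance : Ranked (Formula Pr) :=
  ⟨Quotient.lift (fun A => A.1.rk) fun _ _ h => PreFormula.Equiv.rk_eq h⟩

/-- A formal expression representing the formula `A`. -/
noncomputable def repr (A : Formula Pr) : PreFormula Pr := (Quotient.out A).1

theorem repr_wf (A : Formula Pr) : A.repr.WF := (Quotient.out A).2

theorem repr_rk (A : Formula Pr) : A.repr.rk = Ranked.rk A :=
  congrArg (Ranked.rk (L := Formula Pr)) (Quotient.out_eq A)

/-- A primitive formula. -/
def prim (p : Pr) : Formula Pr := Quotient.mk _ ⟨.prim p, trivial⟩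

/-- The formula `×(M)`; its rank is that of `M`. -/
noncomputable def times (M : Hypergraph (Formula Pr)) : Formula Pr :=
  Quotient.mk _ ⟨.times M.V M.E M.att (fun e => (M.lab e).repr) M.ext,
    fun e => ⟨repr_wf _, (repr_rk _).trans (M.rk_lab e)⟩⟩

/-- The formula `N ÷ D`, where `rk N = rk D`; its rank is that of the hole label of `D`. -/
noncomputable def div (N : Formula Pr) (D : HoleGraph (Formula Pr))
    (h : Ranked.rk N = D.ext.length) : Formula Pr :=
  Quotient.mk _ ⟨.div N.repr D.V D.E D.att (fun e => (D.lab e).repr) D.hole D.ext,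
    ⟨repr_wf _, (repr_rk _).trans h⟩, fun e => ⟨repr_wf _, (repr_rk _).trans (D.rk_lab e)⟩⟩

end Formula

/-- Derivability of a sequent `H → A` in the hypergraph Lambek calculus. Antecedents are considered
up to isomorphism (`iso`). Replacing a hyperedge by a handle is the same as relabeling it, so
`H[e/a^•]` is written as a hypergraph `H` with `lab e = a`, and `D[e/a^•]`, for the hole hyperedge
`e` of `D`, as `D.fill a`. In `divR`, the label put on the hole is immaterial, since this hyperedge
is then replaced by `F`. -/
inductive Derivable {Pr : Type u} [Ranked Pr] : Hypergraph (Formula Pr) → Formula Pr → Prop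
  | iso {G H : Hypergraph (Formula Pr)} {A : Formula Pr} :
      G.Iso H → Derivable G A → Derivable H A
  | ax (A : Formula Pr) : Derivable (Hypergraph.handle A) A
  | timesL (H : Hypergraph (Formula Pr)) (e : H.E) (M : Hypergraph (Formula Pr)) (A : Formula Pr) :
      H.lab e = Formula.times M → Derivable (H.replaceOne e M) A → Derivable H A
  | timesR (M : Hypergraph (Formula Pr)) (H : M.E → Hypergraph (Formula Pr)) :
      (∀ m, Derivable (H m) (M.lab m)) → Derivable (M.replaceAll H) (Formula.times M)
  | divL (H : Hypergraph (Formula Pr)) (e : H.E) (A N : Formula Pr) (D : HoleGraph (Formula Pr))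
      (hD : Ranked.rk N = D.ext.length) (K : D.E → Hypergraph (Formula Pr)) :
      H.lab e = N → Derivable H A → (∀ d, Derivable (K d) (D.lab d)) →
      Derivable (H.replaceOne e
        ((D.fill (Formula.div N D hD) rfl).replace Function.Embedding.some K)) A
  | divR (F : Hypergraph (Formula Pr)) (N : Formula Pr) (D : HoleGraph (Formula Pr))
      (hD : Ranked.rk N = D.ext.length) :
      Ranked.rk F = D.hole.length →
      Derivable ((D.fill (Formula.div N D hD) rfl).replaceOne none F) N →
      Derivable F (Formula.div N D hD)

end HL

namespace NLM

/-- Formulas of the multimodal Lambek calculus with primitive formulas `P`, modes `I` and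
modalities `J`. -/
inductive Formula (P I J : Type u) : Type u
  | prim (p : P) : Formula P I J
  /-- `A •_i B` -/
  | prod (i : I) (A B : Formula P I J) : Formula P I J
  /-- `ldiv i B A` is `B \_i A` -/
  | ldiv (i : I) (B A : Formula P I J) : Formula P I J
  /-- `rdiv i A B` is `A /_i B` -/
  | rdiv (i : I) (A B : Formula P I J) : Formula P I J
  | dia (j : J) (A : Formula P I J) : Formula P I J
  | box (j : J) (A : Formula P I J) : Formula P I J

/-- Structured databases: a formula, `(Π₁, Π₂)^i`, or `⟨Π⟩^j`. -/
inductive Database (P I J : Type u) : Type u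
  | form (A : Formula P I J) : Database P I J
  | pair (i : I) (X Y : Database P I J) : Database P I J
  | bracket (j : J) (X : Database P I J) : Database P I J

/-- Structured databases `Δ[·]` with one distinguished place. -/
inductive Ctx (P I J : Type u) : Type u
  | hole : Ctx P I J
  | pairLeft (i : I) (Δ : Ctx P I J) (Y : Database P I J) : Ctx P I J
  | pairRight (i : I) (X : Database P I J) (Δ : Ctx P I J) : Ctx P I J
  | bracket (j : J) (Δ : Ctx P I J) : Ctx P I J

/-- The structured database `Δ[X]`. -/
def Ctx.plug {P I J : Type u} : Ctx P I J → Database P I J → Database P I J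
  | hole, X => X
  | pairLeft i Δ Y, X => .pair i (Δ.plug X) Y
  | pairRight i Y Δ, X => .pair i Y (Δ.plug X)
  | bracket j Δ, X => .bracket j (Δ.plug X)

open Formula Database in
/-- Derivability of a sequent `Π → A` in the multimodal Lambek calculus with the set `C` of
commutative modes and the set `A` of associative modes. -/
inductive Derivable {P I J : Type u} (C A : Set I) : Database P I J → Formula P I J → Prop
  | ax (T : Formula P I J) : Derivable C A (form T) T
  | prodL (Δ : Ctx P I J) (i : I) (S T U : Formula P I J) :
      Derivable C A (Δ.plug (pair i (form S) (form T))) U →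
      Derivable C A (Δ.plug (form (prod i S T))) U
  | prodR (i : I) (X Y : Database P I J) (S T : Formula P I J) :
      Derivable C A X S → Derivable C A Y T → Derivable C A (pair i X Y) (prod i S T)
  | ldivL (Δ : Ctx P I J) (i : I) (X : Database P I J) (S T U : Formula P I J) :
      Derivable C A (Δ.plug (form S)) U → Derivable C A X T →
      Derivable C A (Δ.plug (pair i X (form (ldiv i T S)))) U
  | ldivR (i : I) (X : Database P I J) (S T : Formula P I J) :
      Derivable C A (pair i (form T) X) S → Derivable C A X (ldiv i T S)
  | rdivL (Δ : Ctx P I J) (i : I) (X : Database P I J) (S T U : Formula P I J) :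
      Derivable C A (Δ.plug (form S)) U → Derivable C A X T →
      Derivable C A (Δ.plug (pair i (form (rdiv i S T)) X)) U
  | rdivR (i : I) (X : Database P I J) (S T : Formula P I J) :
      Derivable C A (pair i X (form T)) S → Derivable C A X (rdiv i S T)
  | diaL (Δ : Ctx P I J) (j : J) (S U : Formula P I J) :
      Derivable C A (Δ.plug (bracket j (form S))) U →
      Derivable C A (Δ.plug (form (dia j S))) U
  | diaR (j : J) (X : Database P I J) (S : Formula P I J) :
      Derivable C A X S → Derivable C A (bracket j X) (dia j S)
  | boxL (Δ : Ctx P I J) (j : J) (S U : Formula P I J) :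
      Derivable C A (Δ.plug (form S)) U →
      Derivable C A (Δ.plug (bracket j (form (box j S)))) U
  | boxR (j : J) (X : Database P I J) (S : Formula P I J) :
      Derivable C A (bracket j X) S → Derivable C A X (box j S)
  | perm (Δ : Ctx P I J) (c : I) (X Y : Database P I J) (U : Formula P I J) : c ∈ C →
      Derivable C A (Δ.plug (pair c X Y)) U → Derivable C A (Δ.plug (pair c Y X)) U
  | assocL (Δ : Ctx P I J) (a : I) (X Y Z : Database P I J) (U : Formula P I J) : a ∈ A →
      Derivable C A (Δ.plug (pair a X (pair a Y Z))) U →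
      Derivable C A (Δ.plug (pair a (pair a X Y) Z)) U
  | assocR (Δ : Ctx P I J) (a : I) (X Y Z : Database P I J) (U : Formula P I J) : a ∈ A →
      Derivable C A (Δ.plug (pair a (pair a X Y) Z)) U →
      Derivable C A (Δ.plug (pair a X (pair a Y Z))) U

end NLM

open HL in
/-- The sets of modes `I` and modalities `J` as disjoint sets of primitive formulas of the hypergraph
Lambek calculus, with the set `C ⊆ I` of commutative modes; noncommutative modes have rank 3,
commutative modes and modalities have rank 2. -/
structure ModeSystem (Pr : Type u) [Ranked Pr] where
  I : Set Pr
  J : Set Pr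
  C : Set I
  disj : Disjoint I J
  rk_mode : ∀ i : I, i ∉ C → Ranked.rk i.1 = 3
  rk_comm : ∀ c : I, c ∈ C → Ranked.rk c.1 = 2
  rk_modality : ∀ j : J, Ranked.rk j.1 = 2

namespace ModeSystem

open HL

section Patterns

variable {L : Type v} [Ranked L]

/-- `R^i(A, B)`; the hyperedges `r₀, r₁, r₂` are `0, 1, 2`. -/
def R (i A B : L) (hi : Ranked.rk i = 3) (hA : Ranked.rk A = 1) (hB : Ranked.rk B = 1) :
    HL.Hypergraph L where
  V := Fin 3
  E := Fin 3
  att := ![[0, 1, 2], [1], [2]]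
  lab := ![i, A, B]
  ext := [0]
  rk_lab := by simp [Fin.forall_fin_succ, hi, hA, hB]

/-- `R^i(B, $₁)` -/
def RHoleRight (i B : L) (hi : Ranked.rk i = 3) (hB : Ranked.rk B = 1) : HoleGraph L where
  V := Fin 3
  E := Fin 2
  att := ![[0, 1, 2], [1]]
  lab := ![i, B]
  hole := [2]
  ext := [0]
  rk_lab := by simp [Fin.forall_fin_succ, hi, hB]

/-- `R^i($₁, B)` -/
def RHoleLeft (i B : L) (hi : Ranked.rk i = 3) (hB : Ranked.rk B = 1) : HoleGraph L where
  V := Fin 3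
  E := Fin 2
  att := ![[0, 1, 2], [2]]
  lab := ![i, B]
  hole := [1]
  ext := [0]
  rk_lab := by simp [Fin.forall_fin_succ, hi, hB]

/-- `K^c(A, B)`; the hyperedges `k₀, k₁, k₂` are `0, 1, 2`. -/
def K (c A B : L) (hc : Ranked.rk c = 2) (hA : Ranked.rk A = 1) (hB : Ranked.rk B = 1) :
    HL.Hypergraph L where
  V := Fin 2
  E := Fin 3
  att := ![[0, 1], [1], [1]]
  lab := ![c, A, B]
  ext := [0]
  rk_lab := by simp [Fin.forall_fin_succ, hc, hA, hB]

/-- `K^c(B, $₁)` -/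
def KHole (c B : L) (hc : Ranked.rk c = 2) (hB : Ranked.rk B = 1) : HoleGraph L where
  V := Fin 2
  E := Fin 2
  att := ![[0, 1], [1]]
  lab := ![c, B]
  hole := [1]
  ext := [0]
  rk_lab := by simp [Fin.forall_fin_succ, hc, hB]

/-- `U^j(A)`; the hyperedges `u₀, u₁` are `0, 1`. -/
def U (j A : L) (hj : Ranked.rk j = 2) (hA : Ranked.rk A = 1) : HL.Hypergraph L where
  V := Fin 2
  E := Fin 2
  att := ![[0, 1], [1]]
  lab := ![j, A]
  ext := [0]
  rk_lab := by simp [Fin.forall_fin_succ, hj, hA]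

/-- `U^j($₁)` -/
def UHole (j : L) (hj : Ranked.rk j = 2) : HoleGraph L where
  V := Fin 2
  E := Fin 1
  att := ![[0, 1]]
  lab := ![j]
  hole := [1]
  ext := [0]
  rk_lab := by simp [hj]

end Patterns

variable {Pr : Type u} [Ranked Pr] (S : ModeSystem Pr)

/-- The formulas of the multimodal Lambek calculus with modes `I` and modalities `J`; its primitive
formulas are the elements of `Pr` of rank 1. -/
abbrev Fm : Type u := NLM.Formula {p : Pr // Ranked.rk p = 1} S.I S.J

/-- The structured databases of the same calculus. -/
abbrev Db : Type u := NLM.Database {p : Pr // Ranked.rk p = 1} S.I S.J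

open Classical in
/-- The translation `μ` of formulas, with the information that `μ(A)` has rank 1. -/
noncomputable def muAux : S.Fm → {A : Formula Pr // Ranked.rk A = 1}
  | .prim p => ⟨.prim p.1, p.2⟩
  | .prod i A B =>
      if h : i ∈ S.C then
        ⟨.times (K (.prim i) (muAux A).1 (muAux B).1 (S.rk_comm i h) (muAux A).2 (muAux B).2), rfl⟩
      else
        ⟨.times (R (.prim i) (muAux A).1 (muAux B).1 (S.rk_mode i h) (muAux A).2 (muAux B).2), rfl⟩
  | .ldiv i B A =>
      if h : i ∈ S.C then
        ⟨.div (muAux A).1 (KHole (.prim i) (muAux B).1 (S.rk_comm i h) (muAux B).2) (muAux A).2, rfl⟩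
      else
        ⟨.div (muAux A).1 (RHoleRight (.prim i) (muAux B).1 (S.rk_mode i h) (muAux B).2)
          (muAux A).2, rfl⟩
  | .rdiv i A B =>
      if h : i ∈ S.C then
        ⟨.div (muAux A).1 (KHole (.prim i) (muAux B).1 (S.rk_comm i h) (muAux B).2) (muAux A).2, rfl⟩
      else
        ⟨.div (muAux A).1 (RHoleLeft (.prim i) (muAux B).1 (S.rk_mode i h) (muAux B).2)
          (muAux A).2, rfl⟩
  | .dia j A => ⟨.times (U (.prim j) (muAux A).1 (S.rk_modality j) (muAux A).2), rfl⟩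
  | .box j A => ⟨.div (muAux A).1 (UHole (.prim j) (S.rk_modality j)) (muAux A).2, rfl⟩

/-- The translation `μ` of formulas. -/
noncomputable def mu (A : S.Fm) : Formula Pr := (S.muAux A).1

/-- A formula of rank 1, used only as a label of hyperedges that are replaced at once, so that it
does not matter which one it is. -/
noncomputable def dummy (Pr : Type u) [Ranked Pr] : {A : Formula Pr // Ranked.rk A = 1} :=
  ⟨.times { V := Unit, E := Empty, att := Empty.elim, lab := Empty.elim, ext := [()],
            rk_lab := fun e => e.elim }, rfl⟩

open Classical in
/-- The translation of structured databases into hypergraphs: `htree(A) = μ(A)^•`,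
`htree((Π₁, Π₂)^i) = R^i[r₁/htree(Π₁), r₂/htree(Π₂)]` for noncommutative `i`,
`htree((Π₁, Π₂)^c) = K^c[k₁/htree(Π₁), k₂/htree(Π₂)]` for commutative `c`, and
`htree(⟨Π⟩^j) = U^j[u₁/htree(Π)]`. -/
noncomputable def htree : S.Db → HL.Hypergraph (Formula Pr)
  | .form A => .handle (S.mu A)
  | .pair i X Y =>
      if h : i ∈ S.C then
        (K (.prim i) (dummy Pr).1 (dummy Pr).1 (S.rk_comm i h) (dummy Pr).2 (dummy Pr).2).replace
          (Fin.succEmb 2) ![htree X, htree Y]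
      else
        (R (.prim i) (dummy Pr).1 (dummy Pr).1 (S.rk_mode i h) (dummy Pr).2 (dummy Pr).2).replace
          (Fin.succEmb 2) ![htree X, htree Y]
  | .bracket j X =>
      (U (.prim j) (dummy Pr).1 (S.rk_modality j) (dummy Pr).2).replaceOne (1 : Fin 2) (htree X)

/-- The labels of hyperedges of translated antecedents: the formulas `μ(A)`, and the modes and
modalities as primitive formulas. -/
def labels : Set (Formula Pr) :=
  Set.range S.mu ∪ Formula.prim '' (S.I ∪ S.J)

end ModeSystem

/-!
`HL` is sound for phase semantics: a formula is valued, at each string of nodes, by a set of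
elements of a commutative monoid that is closed with respect to a family of poles; a hypergraph is
valued by the products of elements in the values of its hyperedges, times the weights of its
internal nodes; and the value of the antecedent of a derivable sequent is contained in the value of
the succedent.

In the direction from `HL` to `NL_◇`, this is applied to a model in the style of Okada. Its elements
are multisets of placed hyperedges together with a multiset of internal nodes, and the pole of
`(v, T)` consists of those that, once their nodes are distinct, form a tree with root `v` whose
database has the type `T`. By induction on `A`, the value of `μ(A)` at `v` contains the single
hyperedge labeled `μ(A)` at `v` and is contained in the pole of `(v, A)`. A hypergraph with distinct
nodes lies in its own value, so if it derives `μ(T)`, it is the tree of a database of type `T`. The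
tree determines the database up to permutations under commutative modes.

The converse direction translates the rules one by one. The required isomorphisms are read off from
the images of hypergraphs in the free commutative monoid, which turn replacement into substitution
of values.
-/

namespace HL

section FiniteSums

variable {α β γ R : Type*} [Finite α] [Finite β]

theorem finsum_sumType [AddCommMonoid R] (f : α ⊕ β → R) :
    ∑ᶠ x, f x = ∑ᶠ a, f (.inl a) + ∑ᶠ b, f (.inr b) := by
  cases nonempty_fintype α
  cases nonempty_fintype β
  simp only [finsum_eq_sum_of_fintype, Fintype.sum_sum_type]

theorem finsum_sigmaType [AddCommMonoid R] {β : α → Type*} [∀ a, Finite (β a)]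
    (f : (Σ a, β a) → R) : ∑ᶠ x, f x = ∑ᶠ a, ∑ᶠ b, f ⟨a, b⟩ := by
  cases nonempty_fintype α
  let _ := fun a => Fintype.ofFinite (β a)
  simp only [finsum_eq_sum_of_fintype, Fintype.sum_sigma]

theorem finsum_optionType [AddCommMonoid R] (f : Option α → R) :
    ∑ᶠ x, f x = f none + ∑ᶠ a, f (some a) := by
  cases nonempty_fintype α
  simp only [finsum_eq_sum_of_fintype, Fintype.sum_option]

theorem finsum_prod_eq {M N : Type*} [AddCommMonoid M] [AddCommMonoid N]
    (x : α → M × N) : ∑ᶠ i, x i = (∑ᶠ i, (x i).1, ∑ᶠ i, (x i).2) :=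
  Prod.ext ((AddMonoidHom.fst M N).map_finsum (Set.toFinite _))
    ((AddMonoidHom.snd M N).map_finsum (Set.toFinite _))

theorem exists_equiv_of_finsum_singleton_eq {f : α → γ} {g : β → γ}
    (h : ∑ᶠ a, ({f a} : Multiset γ) = ∑ᶠ b, {g b}) : ∃ τ : α ≃ β, ∀ a, g (τ a) = f a := by
  classical
  cases nonempty_fintype α
  cases nonempty_fintype β
  have fiberEquiv (c) : Nonempty ({a // f a = c} ≃ {b // g b = c}) := by
    refine ⟨Fintype.equivOfCardEq ?_⟩
    have hc := congrArg (Multiset.count c) h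
    simp only [finsum_eq_sum_of_fintype, Multiset.count_sum', Multiset.count_singleton,
      Finset.sum_boole, Nat.cast_id] at hc
    simpa only [Fintype.card_subtype, eq_comm] using hc
  refine ⟨(Equiv.sigmaFiberEquiv f).symm.trans
    ((Equiv.sigmaCongrRight fun c => (fiberEquiv c).some).trans (Equiv.sigmaFiberEquiv g)),
    fun a => ((fiberEquiv (f a)).some ⟨a, rfl⟩).2⟩

theorem finsum_singleton_eq_map {α β : Type*} [Fintype α] (f : α → β) :
    ∑ᶠ a, ({f a} : Multiset β) = Finset.univ.val.map f := by
  rw [finsum_eq_sum_of_fintype, Finset.sum_eq_multiset_sum]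
  exact (Multiset.map_map .. ▸ Multiset.sum_map_singleton _)

theorem exists_finsum_singleton_of_map_eq {α β γ : Type*} [Finite α] {r : Multiset β} {ψ : β → γ}
    {φ : α → γ} (h : r.map ψ = ∑ᶠ a, {φ a}) :
    ∃ χ : α → β, r = ∑ᶠ a, {χ a} ∧ ∀ a, ψ (χ a) = φ a := by
  classical
  have eq_finsum : ∑ᶠ x : r, {ψ x} = r.map ψ := by
    rw [finsum_singleton_eq_map, Multiset.map_univ]
  obtain ⟨τ, hτ⟩ := exists_equiv_of_finsum_singleton_eq (h.symm.trans eq_finsum.symm)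
  refine ⟨fun a => (τ a : β), ?_, hτ⟩
  rw [finsum_comp_equiv τ (f := fun x : r => ({(x : β)} : Multiset β)), finsum_singleton_eq_map,
    Multiset.map_univ_coe]

end FiniteSums

section Lists

variable {α β : Type*}

theorem nodup_of_length_eq_one {l : List α} (h : l.length = 1) : l.Nodup := by
  obtain ⟨a, rfl⟩ := List.length_eq_one_iff.1 h
  exact List.nodup_singleton a

theorem bijective_of_map_eq {f : α → β} {l : List α} {l' : List β} (h : l.map f = l')
    (hl' : l'.Nodup) (σ : {b // b ∉ l'} ≃ {a // a ∉ l}) (hσ : ∀ b, f (σ b) = b) :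
    Function.Bijective f := by
  have mem_iff (a) : f a ∈ l' ↔ a ∈ l := by
    refine ⟨fun ha => by_contra fun ha' => ?_, fun ha => h ▸ List.mem_map_of_mem ha⟩
    obtain ⟨b, hb⟩ := σ.surjective ⟨a, ha'⟩
    have f_eq : f a = b := by simpa only [hb] using hσ b
    exact b.2 (f_eq ▸ ha)
  constructor
  · intro a a' haa'
    by_cases ha : a ∈ l
    · exact List.inj_on_of_nodup_map (h ▸ hl') ha ((mem_iff a').1 (haa' ▸ (mem_iff a).2 ha)) haa'
    · have ha' : a' ∉ l := fun ha' => ha ((mem_iff a).1 (haa' ▸ (mem_iff a').2 ha'))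
      obtain ⟨b, hb⟩ := σ.surjective ⟨a, ha⟩
      obtain ⟨b', hb'⟩ := σ.surjective ⟨a', ha'⟩
      have f_eq : f a = b := by simpa only [hb] using hσ b
      have f_eq' : f a' = b' := by simpa only [hb'] using hσ b'
      have hbb' : b = b' := Subtype.ext (f_eq.symm.trans (haa'.trans f_eq'))
      exact congrArg Subtype.val (hb.symm.trans ((congrArg σ hbb').trans hb'))
  · intro b
    by_cases hb : b ∈ l'
    · obtain ⟨a, -, ha⟩ := List.mem_map.1 (h ▸ hb)
      exact ⟨a, ha⟩
    · exact ⟨_, hσ ⟨b, hb⟩⟩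

end Lists

section Multisets

variable {α ι : Type*}

theorem exists_fresh [Infinite α] (s : Multiset α) : ∃ a, a ∉ s := by
  classical
  simpa using Infinite.exists_notMem_finset s.toFinset

theorem nodup_add_sum [Fintype ι] {l : Multiset α} {m : ι → Multiset α}
    (h : (l + ∑ k, m k).Nodup) :
    l.Nodup ∧ (∀ k, (m k).Nodup) ∧ (∀ k, Disjoint l (m k)) ∧
      Pairwise fun j k => Disjoint (m j) (m k) := by
  obtain ⟨nodup_l, nodup_sum, disj⟩ := Multiset.nodup_add.1 h
  have le_sum (k) : m k ≤ ∑ k, m k :=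
    Finset.single_le_sum_of_canonicallyOrdered (Finset.mem_univ k)
  refine ⟨nodup_l, fun k => Multiset.nodup_of_le (le_sum k) nodup_sum,
    fun k => disj.mono_right (le_sum k), fun j k hjk => ?_⟩
  have add_le : m j + m k ≤ ∑ k, m k :=
    Finset.add_le_sum (fun _ _ => Multiset.zero_le _) (Finset.mem_univ j) (Finset.mem_univ k) hjk
  exact (Multiset.nodup_add.1 (Multiset.nodup_of_le add_le nodup_sum)).2.2

theorem singleton_add_sum_add {β : Type*} [Fintype ι] (b : β)
    (ρ : ι → Multiset β × Multiset α) (l : List α) :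
    ({b}, 0) + ∑ k, ρ k + (l.map fun a => (0, {a})).sum =
      (b ::ₘ ∑ k, (ρ k).1, ∑ k, (ρ k).2 + (l : Multiset α)) := by
  have sum_eq : (l.map fun a => ((0 : Multiset β), ({a} : Multiset α))).sum = (0, ↑l) := by
    induction l with
    | nil => rfl
    | cons a l ih =>
      rw [List.map_cons, List.sum_cons, ih]
      rfl
  simp [sum_eq, Prod.ext_iff, Prod.fst_sum, Prod.snd_sum]

end Multisets

section Eval

variable {U R : Type*} [AddCommMonoid R]

/-- The value of a hypergraph, given by its attachment function and its string of external nodes,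
in the additive monoid `R`. A node placed at `u : U` weighs `ν u`, and a hyperedge `e` attached to
the string `b` weighs any element of `φ e b`; the value at `a` consists of the total weights of the
hyperedges and the internal nodes, over all placements of the nodes that put the external nodes
at `a`. -/
def eval (ν : U → R) {V E : Type*} (att : E → List V) (ext : List V)
    (φ : E → List U → Set R) (a : List U) : Set R :=
  {r | ∃ (f : V → U) (ρ : E → R), ext.map f = a ∧ (∀ e, ρ e ∈ φ e ((att e).map f)) ∧
    r = ∑ᶠ e, ρ e + ∑ᶠ v : {v // v ∉ ext}, ν (f v)}

variable {ν : U → R}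

theorem eval_subset_eval_of_equiv {V E V' E' : Type*} [Finite V] [Finite E] [Finite V'] [Finite E']
    {att : E → List V} {ext : List V} {att' : E' → List V'} {ext' : List V'}
    {φ : E → List U → Set R} {φ' : E' → List U → Set R} (σ : V ≃ V') (τ : E ≃ E')
    (hatt : ∀ e, att' (τ e) = (att e).map σ) (hφ : ∀ e, φ e = φ' (τ e))
    (hext : ext' = ext.map σ) (a : List U) :
    eval ν att ext φ a ⊆ eval ν att' ext' φ' a := by
  rintro _ ⟨f, ρ, rfl, hρ, rfl⟩
  refine ⟨f ∘ σ.symm, ρ ∘ τ.symm, by simp [hext], fun e => ?_, ?_⟩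
  · obtain ⟨e, rfl⟩ := τ.surjective e
    simpa [hatt, ← hφ, Function.comp_def] using hρ e
  · congr 1
    · exact (finsum_comp_equiv τ.symm (f := ρ)).symm
    · rw [← finsum_comp_equiv
        (σ.subtypeEquiv (p := (· ∉ ext)) (q := (· ∉ ext')) fun v => by simp [hext])]
      simp

theorem eval_eq_eval_of_equiv {V E V' E' : Type*} [Finite V] [Finite E] [Finite V'] [Finite E']
    {att : E → List V} {ext : List V} {att' : E' → List V'} {ext' : List V'}
    {φ : E → List U → Set R} {φ' : E' → List U → Set R} (σ : V ≃ V') (τ : E ≃ E')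
    (hatt : ∀ e, att' (τ e) = (att e).map σ) (hφ : ∀ e, φ e = φ' (τ e))
    (hext : ext' = ext.map σ) :
    eval ν att ext φ = eval ν att' ext' φ' := by
  funext a
  refine (eval_subset_eval_of_equiv σ τ hatt hφ hext a).antisymm
    (eval_subset_eval_of_equiv σ.symm τ.symm (fun e => ?_) (fun e => ?_) ?_ a)
  · simpa using congrArg (List.map σ.symm) (hatt (τ.symm e)).symm
  · simp [hφ]
  · simp [hext]

end Eval

namespace Hypergraph

variable {L : Type v} [Ranked L] {U R : Type*} [AddCommMonoid R]

section Replace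

variable {G : Hypergraph L} {ι : Type} {m : ι ↪ G.E} {H : ι → Hypergraph L}

variable (m H) in
/-- The node of a replacement that comes from a node of the host. -/
def inHost (v : G.V) : (G.replace m H).V := Quot.mk _ (.inl v)

variable (m H) in
/-- The node of a replacement that comes from a node of an inserted hypergraph. -/
def inPart (i : ι) (w : (H i).V) : (G.replace m H).V := Quot.mk _ (.inr ⟨i, w⟩)

theorem ext_map_inPart (hlen : ∀ i, (H i).ext.length = (G.att (m i)).length) (i : ι) :
    (H i).ext.map (inPart m H i) = (G.att (m i)).map (inHost m H) := by
  refine List.ext_getElem (by simp [hlen]) fun k hk hk' => ?_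
  simp only [List.getElem_map]
  exact (Quot.sound ⟨i, k, _, _, by simp, by simp, rfl, rfl⟩).symm

theorem exists_placement_replace {U : Type*} {f : G.V → U} {g : ∀ i, (H i).V → U}
    (hfg : ∀ i, (H i).ext.map (g i) = (G.att (m i)).map f) :
    ∃ h : (G.replace m H).V → U, (∀ v, h (inHost m H v) = f v) ∧
      ∀ i w, h (inPart m H i w) = g i w := by
  refine ⟨Quot.lift (Sum.elim f fun p => g p.1 p.2) ?_, fun _ => rfl, fun _ _ => rfl⟩
  rintro _ _ ⟨i, k, v, w, hv, hw, rfl, rfl⟩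
  have getElem_eq := congrArg (·[k]?) (hfg i)
  simpa [hv, hw, eq_comm] using getElem_eq

/-- The nodes of a replacement: those of the host and the internal nodes of the inserted
hypergraphs. -/
noncomputable def nodeEquiv (hlen : ∀ i, (H i).ext.length = (G.att (m i)).length)
    (hH : ∀ i, (H i).ext.Nodup) :
    G.V ⊕ (Σ i, {w : (H i).V // w ∉ (H i).ext}) ≃ (G.replace m H).V := by
  classical
  let place : G.V ⊕ (Σ i, (H i).V) → G.V ⊕ Σ i, {w : (H i).V // w ∉ (H i).ext} :=
    Sum.elim .inl fun p => if hp : p.2 ∈ (H p.1).ext then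
        .inl ((G.att (m p.1))[(H p.1).ext.idxOf p.2]'(hlen p.1 ▸ List.idxOf_lt_length_iff.2 hp))
      else .inr ⟨p.1, p.2, hp⟩
  have place_glue (x y) (h : Glue G m H x y) : place x = place y := by
    obtain ⟨i, k, v, w, hv, hw, rfl, rfl⟩ := h
    obtain ⟨hk, rfl⟩ := List.getElem?_eq_some_iff.1 hv
    obtain ⟨hk', rfl⟩ := List.getElem?_eq_some_iff.1 hw
    simp [place, (hH i).idxOf_getElem]
  refine ⟨Sum.elim (inHost m H) fun p => inPart m H p.1 p.2.1, Quot.lift place place_glue, ?_, ?_⟩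
  · rintro (v | ⟨i, w, hw⟩)
    · rfl
    · exact dif_neg hw
  · rintro ⟨v | ⟨i, w⟩⟩
    · rfl
    · by_cases hw : w ∈ (H i).ext
      · have hk : (H i).ext.idxOf w < (G.att (m i)).length :=
          hlen i ▸ List.idxOf_lt_length_iff.2 hw
        have glue : Glue G m H (.inl (G.att (m i))[(H i).ext.idxOf w]) (.inr ⟨i, w⟩) :=
          ⟨i, (H i).ext.idxOf w, _, w, List.getElem?_eq_getElem hk, by simp [hw], rfl, rfl⟩
        exact (congrArg _ (dif_pos hw)).trans (Quot.sound glue)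
      · exact congrArg _ (dif_neg hw)

theorem inHost_injective (hlen : ∀ i, (H i).ext.length = (G.att (m i)).length)
    (hH : ∀ i, (H i).ext.Nodup) : Function.Injective (inHost m H) :=
  (nodeEquiv hlen hH).injective.comp Sum.inl_injective

theorem finsum_replace_nodes (hlen : ∀ i, (H i).ext.length = (G.att (m i)).length)
    (hH : ∀ i, (H i).ext.Nodup) (f : (G.replace m H).V → R) :
    ∑ᶠ v : {v // v ∉ (G.replace m H).ext}, f v = ∑ᶠ v : {v // v ∉ G.ext}, f (inHost m H v) +
      ∑ᶠ i, ∑ᶠ w : {w // w ∉ (H i).ext}, f (inPart m H i w) := by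
  have : Finite ι := Finite.of_injective m m.injective
  have mem_ext (z) : nodeEquiv hlen hH z ∈ (G.replace m H).ext ↔ ∃ v ∈ G.ext, .inl v = z := by
    change _ ∈ G.ext.map (inHost m H) ↔ _
    simp only [List.mem_map, ← (nodeEquiv hlen hH).apply_eq_iff_eq]
    rfl
  let inner : {v // v ∉ G.ext} ⊕ (Σ i, {w // w ∉ (H i).ext}) → {v // v ∉ (G.replace m H).ext} :=
    fun z => ⟨nodeEquiv hlen hH (z.map Subtype.val id), by
      rw [mem_ext]; rcases z with v | w; exacts [by simpa using v.2, by simp]⟩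
  have inner_bijective : inner.Bijective := by
    refine ⟨fun x y h => ?_, fun ⟨q, hq⟩ => ?_⟩
    · exact Function.Injective.sumMap Subtype.val_injective Function.injective_id
        ((nodeEquiv hlen hH).injective (congrArg Subtype.val h))
    · obtain ⟨v | w, rfl⟩ := (nodeEquiv hlen hH).surjective q
      · exact ⟨.inl ⟨v, fun hv => hq ((mem_ext _).2 ⟨v, hv, rfl⟩)⟩, rfl⟩
      · exact ⟨.inr w, rfl⟩
  rw [← finsum_comp_equiv (Equiv.ofBijective inner inner_bijective), finsum_sumType,
    finsum_sigmaType]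
  rfl

/-- The hyperedges of the host of a replacement: those that are kept and those that are replaced. -/
noncomputable def hostEdgeEquiv (m : ι ↪ G.E) : {e // ∀ i, m i ≠ e} ⊕ ι ≃ G.E := by
  refine Equiv.ofBijective (Sum.elim Subtype.val m)
    ⟨Subtype.val_injective.sumElim m.injective fun e i => (e.2 i).symm, fun e => ?_⟩
  by_cases h : ∃ i, m i = e
  · exact h.elim fun i hi => ⟨.inr i, hi⟩
  · exact ⟨.inl ⟨e, not_exists.1 h⟩, rfl⟩

theorem length_ext_replace : (G.replace m H).ext.length = G.ext.length := List.length_map ..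

theorem nodup_ext_replace_iff (hlen : ∀ i, (H i).ext.length = (G.att (m i)).length)
    (hH : ∀ i, (H i).ext.Nodup) : (G.replace m H).ext.Nodup ↔ G.ext.Nodup :=
  List.nodup_map_iff (inHost_injective hlen hH)

variable (m H) in
/-- The hyperedge of a replacement that comes from a hyperedge of the host. -/
def keptEdge (e : {e // ∀ i, m i ≠ e}) : (G.replace m H).E := .inl e

variable (m H) in
/-- The hyperedge of a replacement that comes from a hyperedge of an inserted hypergraph. -/
def partEdge (i : ι) (e : (H i).E) : (G.replace m H).E := .inr ⟨i, e⟩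

theorem finsum_replace_edges (f : (G.replace m H).E → R) :
    ∑ᶠ e, f e = ∑ᶠ e, f (keptEdge m H e) + ∑ᶠ i, ∑ᶠ e, f (partEdge m H i e) := by
  have : Finite ι := Finite.of_injective m m.injective
  exact (finsum_sumType (α := {e // ∀ i, m i ≠ e}) (β := Σ i, (H i).E) f).trans
    (congrArg _ (finsum_sigmaType _))

theorem finsum_host_edges (m : ι ↪ G.E) (f : G.E → R) :
    ∑ᶠ e, f e = ∑ᶠ e : {e // ∀ i, m i ≠ e}, f e + ∑ᶠ i, f (m i) := by
  have : Finite ι := Finite.of_injective m m.injective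
  rw [← finsum_comp_equiv (hostEdgeEquiv m), finsum_sumType]
  rfl

variable {ν : U → R} {φ : (G.replace m H).E → List U → Set R} {ψ : G.E → List U → Set R}

theorem eval_replace_subset (hlen : ∀ i, (H i).ext.length = (G.att (m i)).length)
    (hH : ∀ i, (H i).ext.Nodup)
    (hm : ∀ i, eval ν (H i).att (H i).ext (fun e => φ (partEdge m H i e)) ≤ ψ (m i))
    (hn : ∀ e, φ (keptEdge m H e) ≤ ψ e) (a : List U) :
    eval ν (G.replace m H).att (G.replace m H).ext φ a ⊆ eval ν G.att G.ext ψ a := by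
  have : Finite ι := Finite.of_injective m m.injective
  rintro _ ⟨f, ρ, rfl, hρ, rfl⟩
  let partWeight (i : ι) : R :=
    ∑ᶠ d, ρ (partEdge m H i d) + ∑ᶠ w : {w // w ∉ (H i).ext}, ν (f (inPart m H i w))
  let weight : G.E → R := Sum.elim (ρ ∘ keptEdge m H) partWeight ∘ (hostEdgeEquiv m).symm
  have weight_kept (e : {e // ∀ i, m i ≠ e}) : weight e = ρ (keptEdge m H e) :=
    congrArg (Sum.elim _ _) ((hostEdgeEquiv m).symm_apply_apply (.inl e))
  have weight_part (i) : weight (m i) = partWeight i :=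
    congrArg (Sum.elim _ _) ((hostEdgeEquiv m).symm_apply_apply (.inr i))
  refine ⟨f ∘ inHost m H, weight, (List.map_map ..).symm, fun e => ?_, ?_⟩
  · rw [← List.map_map]
    obtain ⟨e | i, rfl⟩ := (hostEdgeEquiv m).surjective e
    · exact hn e _ (weight_kept e ▸ hρ (keptEdge m H e))
    · refine hm i _ ?_
      change weight (m i) ∈ eval ν _ _ _ (((G.att (m i)).map (inHost m H)).map f)
      rw [weight_part, ← ext_map_inPart hlen]
      exact ⟨f ∘ inPart m H i, _, (List.map_map ..).symm,
        fun d => List.map_map (f := inPart m H i) ▸ hρ (partEdge m H i d), rfl⟩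
  · rw [finsum_host_edges m, finsum_replace_edges, finsum_replace_nodes hlen hH fun v => ν (f v)]
    simp only [weight_kept, weight_part, partWeight, Function.comp_apply,
      finsum_add_distrib (Set.toFinite _) (Set.toFinite _)]
    abel

theorem eval_subset_eval_replace (hlen : ∀ i, (H i).ext.length = (G.att (m i)).length)
    (hH : ∀ i, (H i).ext.Nodup)
    (hm : ∀ i, ψ (m i) ≤ eval ν (H i).att (H i).ext fun e => φ (partEdge m H i e))
    (hn : ∀ e : {e // ∀ i, m i ≠ e}, ψ e ≤ φ (keptEdge m H e)) (a : List U) :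
    eval ν G.att G.ext ψ a ⊆ eval ν (G.replace m H).att (G.replace m H).ext φ a := by
  have : Finite ι := Finite.of_injective m m.injective
  rintro _ ⟨f, ρ, rfl, hρ, rfl⟩
  choose g σ hg hσ hρg using fun i => hm i _ (hρ (m i))
  obtain ⟨h, hf, hgh⟩ := exists_placement_replace hg
  obtain rfl : h ∘ inHost m H = f := funext hf
  obtain rfl : (fun i => h ∘ inPart m H i) = g := funext₂ hgh
  let weight : (G.replace m H).E → R := Sum.elim (fun e => ρ e) fun p => σ p.1 p.2
  refine ⟨h, weight, List.map_map .., ?_, ?_⟩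
  · rintro (e | ⟨i, e⟩)
    · have mem_φ := hn e _ (hρ e)
      rwa [← List.map_map] at mem_φ
    · have mem_φ := hσ i e
      rwa [← List.map_map] at mem_φ
  · rw [finsum_host_edges m, finsum_replace_edges, finsum_replace_nodes hlen hH fun v => ν (h v)]
    simp only [hρg, Function.comp_apply, finsum_add_distrib (Set.toFinite _) (Set.toFinite _)]
    have weight_part (i) : ∑ᶠ e, weight (partEdge m H i e) = ∑ᶠ e, σ i e := rfl
    have weight_kept : ∑ᶠ e, weight (keptEdge m H e) = ∑ᶠ e : {e // ∀ i, m i ≠ e}, ρ e := rfl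
    simp only [weight_part, weight_kept]
    abel

theorem eval_replace (hlen : ∀ i, (H i).ext.length = (G.att (m i)).length)
    (hH : ∀ i, (H i).ext.Nodup)
    (hm : ∀ i, ψ (m i) = eval ν (H i).att (H i).ext fun e => φ (partEdge m H i e))
    (hn : ∀ e : {e // ∀ i, m i ≠ e}, ψ e = φ (keptEdge m H e)) :
    eval ν (G.replace m H).att (G.replace m H).ext φ = eval ν G.att G.ext ψ :=
  funext fun a => (eval_replace_subset hlen hH (fun i => (hm i).ge) (fun e => (hn e).ge) a).antisymm
    (eval_subset_eval_replace hlen hH (fun i => (hm i).le) (fun e => (hn e).le) a)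

theorem forall_lab_replace {p : L → Prop} : (∀ e, p ((G.replace m H).lab e)) ↔
    (∀ e, (∀ i, m i ≠ e) → p (G.lab e)) ∧ ∀ i e, p ((H i).lab e) :=
  Sum.forall.trans (and_congr Subtype.forall Sigma.forall)

theorem forall_lab_of_replace {p : L → Prop} (h : ∀ e, p ((G.replace m H).lab e))
    (hm : ∀ i, p (G.lab (m i))) (e : G.E) : p (G.lab e) := by
  by_cases he : ∃ i, m i = e
  · obtain ⟨i, rfl⟩ := he
    exact hm i
  · exact (forall_lab_replace.1 h).1 e (not_exists.1 he)

end Replace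

section Iso

variable {G H M : Hypergraph L}

theorem Iso.refl (G : Hypergraph L) : G.Iso G :=
  ⟨.refl _, .refl _, by simp, fun _ => rfl, by simp⟩

theorem Iso.trans (h : G.Iso H) (h' : H.Iso M) : G.Iso M := by
  obtain ⟨σ, τ, hatt, hlab, hext⟩ := h
  obtain ⟨σ', τ', hatt', hlab', hext'⟩ := h'
  exact ⟨σ.trans σ', τ.trans τ', by simp [hatt', hatt], by simp [hlab', hlab],
    by simp [hext', hext]⟩

theorem Iso.symm (h : G.Iso H) : H.Iso G := by
  obtain ⟨σ, τ, hatt, hlab, hext⟩ := h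
  refine ⟨σ.symm, τ.symm, fun e => ?_, fun e => ?_, ?_⟩
  · simpa using congrArg (List.map σ.symm) (hatt (τ.symm e)).symm
  · simpa using (hlab (τ.symm e)).symm
  · simp [hext]

end Iso

theorem mem_eval_handle {ν : U → R} {a : L}
    {φ : (handle a).E → List U → Set R} {b : List U} {r : R} :
    r ∈ eval ν (handle a).att (handle a).ext φ b ↔ b.length = Ranked.rk a ∧ r ∈ φ () b := by
  have : IsEmpty {v // v ∉ (handle a).ext} := ⟨fun v => v.2 (List.mem_finRange _)⟩
  have : Unique (handle a).E := inferInstanceAs (Unique Unit)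
  have weight_eq (f : (handle a).V → U) (ρ : (handle a).E → R) :
      ∑ᶠ e, ρ e + ∑ᶠ v : {v // v ∉ (handle a).ext}, ν (f v) = ρ () := by
    rw [finsum_of_isEmpty (fun v : {v // v ∉ (handle a).ext} => ν (f v)), add_zero, finsum_unique]
    rfl
  constructor
  · rintro ⟨f, ρ, rfl, hρ, rfl⟩
    exact ⟨List.length_map _ |>.trans List.length_finRange, weight_eq f ρ ▸ hρ ()⟩
  · rintro ⟨hb, hr⟩
    have hmap : (List.finRange (Ranked.rk a)).map (fun i => b[i]) = b :=
      List.ext_getElem (by simp [hb]) (by simp)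
    exact ⟨fun i : Fin _ => b[i], fun _ => r, hmap, fun _ => hmap.symm ▸ hr,
      (weight_eq (fun i : Fin _ => b[i]) fun _ => r).symm⟩

section Image

variable {G H M : Hypergraph L}

/-- The multiset of labeled hyperedges and the multiset of internal nodes of a hypergraph whose
nodes are placed in `U`. -/
abbrev Config (L U : Type*) := Multiset (L × List U) × Multiset U

/-- The configuration of a placed hypergraph. -/
noncomputable def image (G : Hypergraph L) (f : G.V → U) : Config L U :=
  (∑ᶠ e, {(G.lab e, (G.att e).map f)}, ∑ᶠ v : {v // v ∉ G.ext}, {f v})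

/-- The configuration of a single node. -/
def nodeConfig (L : Type*) (u : U) : Config L U := (0, {u})

/-- The configuration of a single hyperedge labeled by `a`. -/
def edgeConfig (a : L) (b : List U) : Set (Config L U) := {({(a, b)}, 0)}

/-- The configurations of the placements of `G`: its value in the free monoid. -/
noncomputable def images (G : Hypergraph L) : List U → Set (Config L U) :=
  eval (nodeConfig L) G.att G.ext fun e => edgeConfig (G.lab e)

theorem mem_images {a : List U} {r : Config L U} :
    r ∈ G.images a ↔ ∃ f : G.V → U, G.ext.map f = a ∧ r = G.image f := by
  have image_eq (f : G.V → U) : G.image f = ∑ᶠ e, (({(G.lab e, (G.att e).map f)}, 0) : Config L U) +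
      ∑ᶠ v : {v // v ∉ G.ext}, nodeConfig L (f v) := by
    simp [finsum_prod_eq, image, nodeConfig]
  constructor
  · rintro ⟨f, ρ, ha, hρ, rfl⟩
    exact ⟨f, ha, by rw [image_eq, funext hρ]⟩
  · rintro ⟨f, ha, rfl⟩
    exact ⟨f, _, ha, fun e => rfl, image_eq f⟩

theorem iso_of_image_eq (hG : G.ext.Nodup) {f : G.V → U} {g : H.V → U}
    (hf : Function.Injective f) (hext : H.ext.map g = G.ext.map f) (h : G.image f = H.image g) :
    G.Iso H := by
  obtain ⟨τ, hτ⟩ := exists_equiv_of_finsum_singleton_eq (congrArg Prod.fst h)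
  obtain ⟨σ, hσ⟩ := exists_equiv_of_finsum_singleton_eq (congrArg Prod.snd h)
  have exists_preimage (w) : ∃ v, f v = g w := by
    by_cases hw : w ∈ H.ext
    · obtain ⟨v, -, hv⟩ := List.mem_map.1 (hext ▸ List.mem_map_of_mem (f := g) hw)
      exact ⟨v, hv⟩
    · exact ⟨_, by simpa using (hσ (σ.symm ⟨w, hw⟩)).symm⟩
  choose k hk using exists_preimage
  obtain rfl : f ∘ k = g := funext hk
  have ext_eq : H.ext.map k = G.ext := hf.list_map (by rw [List.map_map, hext])
  let e := Equiv.ofBijective k (bijective_of_map_eq ext_eq hG σ fun v => hf (hσ v))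
  have map_symm {l : List H.V} {l' : List G.V} (hl : l.map k = l') : l = l'.map e.symm := by
    rw [← hl, List.map_map]
    exact (e.symm_comp_self ▸ List.map_id l).symm
  refine ⟨e.symm, τ, fun d => map_symm (hf.list_map ?_), fun d => congrArg Prod.fst (hτ d),
    map_symm ext_eq⟩
  rw [List.map_map]
  exact congrArg Prod.snd (hτ d)

theorem iso_of_image_mem_images (hG : G.ext.Nodup) {f : G.V → U}
    (hf : Function.Injective f) (h : G.image f ∈ H.images (G.ext.map f)) : G.Iso H :=
  have ⟨_, hext, hg⟩ := mem_images.1 h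
  iso_of_image_eq hG hf hext hg

theorem iso_of_images_subset (hG : G.ext.Nodup)
    (h : (G.images G.ext : Set (Config L G.V)) ⊆ H.images G.ext) : G.Iso H :=
  iso_of_image_mem_images hG Function.injective_id
    (by simpa using h (mem_images.2 ⟨id, List.map_id _, rfl⟩))

theorem Iso.images_eq (h : G.Iso H) : (G.images : List U → Set (Config L U)) = H.images := by
  obtain ⟨σ, τ, hatt, hlab, hext⟩ := h
  exact eval_eq_eval_of_equiv σ τ hatt (fun e => by rw [hlab]) hext

theorem images_replace {ι : Type} {m : ι ↪ G.E} {H : ι → Hypergraph L}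
    (hlen : ∀ i, (H i).ext.length = (G.att (m i)).length) (hH : ∀ i, (H i).ext.Nodup) :
    ((G.replace m H).images : List U → Set (Config L U)) =
      eval (nodeConfig L) G.att G.ext
        (Function.extend m (fun i => (H i).images) fun e => edgeConfig (G.lab e)) :=
  eval_replace hlen hH (fun _ => m.injective.extend_apply ..)
    fun e => Function.extend_apply' _ _ _ fun ⟨i, hi⟩ => e.2 i hi

theorem images_replaceAll {H : G.E → Hypergraph L}
    (hlen : ∀ e, (H e).ext.length = (G.att e).length) (hH : ∀ e, (H e).ext.Nodup) :
    ((G.replaceAll H).images : List U → Set (Config L U)) =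
      eval (nodeConfig L) G.att G.ext fun e => (H e).images :=
  eval_replace hlen hH (fun _ => rfl) fun e => (e.2 e rfl).elim

theorem images_handle {a : L} {b : List U} (hb : b.length = Ranked.rk a) :
    (handle a).images b = edgeConfig a b :=
  Set.ext fun _ => mem_eval_handle.trans (and_iff_right hb)

theorem handle_replaceOne_iso {a : L}
    (hM : M.ext.length = Ranked.rk a) (hM' : M.ext.Nodup) :
    ((handle a).replaceOne () M).Iso M := by
  have hlen : M.ext.length = ((handle a).att ()).length := hM.trans List.length_finRange.symm
  refine iso_of_images_subset ((nodup_ext_replace_iff (fun _ => hlen) fun _ => hM').2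
    (List.nodup_finRange _)) ?_
  have images_eq {U : Type} : ((handle a).replaceOne () M).images =
      eval (nodeConfig (U := U) L) (handle a).att (handle a).ext fun _ => M.images :=
    eval_replace (fun _ => hlen) (fun _ => hM') (fun _ => rfl) fun e => (e.2 () rfl).elim
  rw [images_eq]
  exact fun _ hr => (mem_eval_handle.1 hr).2

open Classical in
theorem images_replaceOne {e : G.E} (hM : M.ext.length = (G.att e).length) (hM' : M.ext.Nodup) :
    ((G.replaceOne e M).images : List U → Set (Config L U)) =
      eval (nodeConfig L) G.att G.ext
        (Function.update (fun d => edgeConfig (G.lab d)) e M.images) :=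
  eval_replace (fun _ => hM) (fun _ => hM') (fun _ => Function.update_self ..)
    fun d => Function.update_of_ne (d.2 ()).symm ..

theorem images_replaceOne_partEdge {ι : Type} [DecidableEq ι] {m : ι ↪ G.E} {H : ι → Hypergraph L}
    (hlen : ∀ i, (H i).ext.length = (G.att (m i)).length) (hH : ∀ i, (H i).ext.Nodup) {k : ι}
    {e : (H k).E} (hM : M.ext.length = ((H k).att e).length) (hM' : M.ext.Nodup) :
    (((G.replace m H).replaceOne (partEdge m H k e) M).images : List U → Set (Config L U)) =
      eval (nodeConfig L) G.att G.ext (Function.extend m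
        (Function.update (fun i => (H i).images) k ((H k).replaceOne e M).images)
        fun d => edgeConfig (G.lab d)) := by
  classical
  have partEdge_injective (i) : Function.Injective (partEdge m H i) :=
    Sum.inr_injective.comp sigma_mk_injective
  rw [images_replaceOne (hM.trans (List.length_map _).symm) hM']
  let label (d : (G.replace m H).E) : List U → Set (Config L U) :=
    edgeConfig ((G.replace m H).lab d)
  refine eval_replace hlen hH (fun i => ?_) fun d => ?_
  · rw [m.injective.extend_apply]
    obtain rfl | hi := eq_or_ne i k
    · rw [Function.update_self, images_replaceOne hM hM']
      exact congrArg (eval _ _ _)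
        (Function.update_comp_eq_of_injective label (partEdge_injective i) e M.images).symm
    · rw [Function.update_of_ne hi]
      have partEdge_ne (d) : partEdge m H i d ≠ partEdge m H k e := fun hd =>
        hi (congrArg Sigma.fst (Sum.inr_injective hd))
      exact congrArg (eval _ _ _)
        (Function.update_comp_eq_of_forall_ne label M.images partEdge_ne).symm
  · rw [Function.extend_apply' _ _ _ fun ⟨i, hi⟩ => d.2 i hi]
    have keptEdge_ne : keptEdge m H d ≠ partEdge m H k e := Sum.inl_ne_inr
    exact (Function.update_of_ne keptEdge_ne M.images label).symm

theorem images_fill_replace {D : HoleGraph L} {a : L} {ha : Ranked.rk a = D.hole.length}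
    {H : D.E → Hypergraph L} (hlen : ∀ d, (H d).ext.length = (D.att d).length)
    (hH : ∀ d, (H d).ext.Nodup) :
    (((D.fill a ha).replace Function.Embedding.some H).images : List U → Set (Config L U)) =
      eval (nodeConfig L) (fun e : Option D.E => e.elim D.hole D.att) D.ext
        fun e => e.elim (edgeConfig a) fun d => (H d).images := by
  refine eval_replace hlen hH (fun _ => rfl) ?_
  rintro ⟨_ | d, hd⟩
  exacts [rfl, (hd d rfl).elim]

theorem images_fill_replaceOne {D : HoleGraph L} {a : L} {ha : Ranked.rk a = D.hole.length}
    (hM : M.ext.length = D.hole.length) (hM' : M.ext.Nodup) :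
    (((D.fill a ha).replaceOne none M).images : List U → Set (Config L U)) =
      eval (nodeConfig L) (fun e : Option D.E => e.elim D.hole D.att) D.ext
        fun e => e.elim M.images fun d => edgeConfig (D.lab d) := by
  refine eval_replace (fun _ => hM) (fun _ => hM') (fun _ => rfl) ?_
  rintro ⟨_ | d, hd⟩
  exacts [(hd () rfl).elim, rfl]

theorem nodup_map_ext_add_image_snd (hG : G.ext.Nodup) {f : G.V → U} (hf : Function.Injective f) :
    ((G.ext.map f : Multiset U) + (G.image f).2).Nodup := by
  cases nonempty_fintype {v // v ∉ G.ext}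
  have inner_eq : (G.image f).2 = Finset.univ.val.map fun v : {v // v ∉ G.ext} => f v :=
    finsum_singleton_eq_map _
  rw [inner_eq, Multiset.nodup_add]
  refine ⟨hG.map hf, Finset.univ.nodup.map (hf.comp Subtype.val_injective), ?_⟩
  rw [Multiset.disjoint_left]
  rintro u hu hw
  obtain ⟨v, hv, rfl⟩ := List.mem_map.1 (Multiset.mem_coe.1 hu)
  obtain ⟨w, -, hw⟩ := Multiset.mem_map.1 hw
  exact w.2 (hf hw ▸ hv)

end Image

end Hypergraph

/-- A phase model: nodes are placed in `U`, and `pole g`, for a goal `g`, is the set of elements of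
`R` that establish `g`. -/
structure PhaseModel (Pr : Type u) (U Goal R : Type*) [AddCommMonoid R] where
  weight : U → R
  val : Pr → List U → Set R
  pole : Goal → Set R

variable {Pr : Type u} {U Goal R : Type*} [AddCommMonoid R]

namespace PhaseModel

variable (M : PhaseModel Pr U Goal R)

/-- The elements of `R` that establish a goal in every context in which all elements of `s` do. -/
def closure (s : Set R) : Set R :=
  {r | ∀ g c, (∀ t ∈ s, t + c ∈ M.pole g) → r + c ∈ M.pole g}

theorem subset_closure (s : Set R) : s ⊆ M.closure s := fun r hr _ _ h => h r hr

theorem closure_mono {s t : Set R} (h : s ⊆ t) : M.closure s ⊆ M.closure t :=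
  fun _ hr g c ht => hr g c fun x hx => ht x (h hx)

theorem closure_closure_subset (s : Set R) : M.closure (M.closure s) ⊆ M.closure s :=
  fun _ hr g c hs => hr g c fun _ ht => ht g c hs

theorem eval_subset_of_eval_subset_of_closure {V E : Type*} [Finite E] {att : E → List V}
    {ext : List V} {φ ψ : E → List U → Set R} {s : Set R} {a : List U} (d : E)
    (hd : ∀ b, φ d b ⊆ M.closure (ψ d b)) (hne : ∀ e ≠ d, φ e = ψ e) (hs : M.closure s ⊆ s)
    (h : eval M.weight att ext ψ a ⊆ s) : eval M.weight att ext φ a ⊆ s := by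
  classical
  cases nonempty_fintype E
  rintro _ ⟨f, ρ, rfl, hρ, rfl⟩
  refine hs fun g c hc => ?_
  have sum_eq (ρ' : E → R) : ∑ᶠ e, ρ' e = ρ' d + ∑ e ∈ {d}ᶜ, ρ' e := by
    rw [finsum_eq_sum_of_fintype, Fintype.sum_eq_add_sum_compl d]
  rw [sum_eq, add_assoc, add_assoc]
  refine hd _ (hρ d) g _ fun t ht => ?_
  have := hc _ (h ⟨f, Function.update ρ d t, rfl, fun e => ?_, rfl⟩)
  · rw [sum_eq, Function.update_self, add_assoc, add_assoc] at this
    have update_eq (e) (he : e ∈ ({d}ᶜ : Finset E)) : Function.update ρ d t e = ρ e :=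
      Function.update_of_ne (by simpa using he) ..
    rwa [Finset.sum_congr rfl update_eq] at this
  · obtain rfl | he := eq_or_ne e d
    · rwa [Function.update_self]
    · rw [Function.update_of_ne he]
      exact hne e he ▸ hρ e

end PhaseModel

/-- The value of a hyperedge that is known to be attached to `a` and to weigh `r`. -/
def edgeVal (a : List U) (r : R) (b : List U) : Set R := {t | b = a ∧ t = r}

namespace PreFormula

/-- The value of a formula in a phase model: its rank-`n` part consists of the weights of the
hyperedges attached to `a`, `|a| = n`, that the formula labels. -/
def sem (M : PhaseModel Pr U Goal R) : PreFormula Pr → List U → Set R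
  | prim p => fun a => M.closure (M.val p a)
  | times _ _ att lab ext => fun a => M.closure (eval M.weight att ext (fun e => (lab e).sem M) a)
  | div N _ E att lab hole ext => fun a => {r | ∀ b,
      eval M.weight (fun e : Option E => e.elim hole att) ext
        (fun e => e.elim (edgeVal a r) fun d => (lab d).sem M) b ⊆ N.sem M b}

/-- External nodes are distinct, and hole labels have rank at most 1. Replacing a hyperedge by
such a hypergraph, or replacing such a hole, identifies no two nodes of the host. -/
def IsSimple : PreFormula Pr → Prop
  | prim _ => True
  | times _ _ _ lab ext => ext.Nodup ∧ ∀ e, (lab e).IsSimple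
  | div N _ _ _ lab hole ext =>
    (N.IsSimple ∧ ext.Nodup ∧ hole.length ≤ 1) ∧ ∀ e, (lab e).IsSimple

variable (M : PhaseModel Pr U Goal R)

theorem Equiv.sem_eq {A B : PreFormula Pr} (h : A.Equiv B) : A.sem M = B.sem M := by
  induction h with
  | prim p => rfl
  | @times _ _ _ _ _ _ _ _ _ lab _ _ lab' _ σ τ hatt _ hext ih =>
    simp only [sem, eval_eq_eval_of_equiv (φ := fun e => (lab e).sem M)
      (φ' := fun e => (lab' e).sem M) σ τ hatt ih hext]
  | @div _ _ _ _ _ _ _ _ _ _ att lab hole _ att' lab' hole' _ _ σ τ hatt _ hhole hext ihN ih =>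
    have eval_eq (a : List U) (r : R) := eval_eq_eval_of_equiv (ν := M.weight)
      (att := fun e => e.elim hole att) (att' := fun e => e.elim hole' att')
      (φ := fun e => e.elim (edgeVal a r) fun d => (lab d).sem M)
      (φ' := fun e => e.elim (edgeVal a r) fun d => (lab' d).sem M)
      σ (Equiv.optionCongr τ) (Option.forall.2 ⟨hhole, hatt⟩) (Option.forall.2 ⟨rfl, ih⟩) hext
    funext a
    exact Set.ext fun r => forall_congr' fun b => by rw [ihN, ← eval_eq]

theorem Equiv.isSimple_iff {A B : PreFormula Pr} (h : A.Equiv B) : A.IsSimple ↔ B.IsSimple := by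
  induction h with
  | prim p => rfl
  | times σ τ _ _ hext ih =>
    simp only [IsSimple, hext, List.nodup_map_iff σ.injective, ih]
    rw [τ.forall_congr_left]
    simp
  | div _ σ τ _ _ hhole hext ihN ih =>
    simp only [IsSimple, hext, hhole, List.length_map, List.nodup_map_iff σ.injective, ih, ihN]
    rw [τ.forall_congr_left]
    simp

theorem closure_sem_subset (A : PreFormula Pr) (a : List U) :
    M.closure (A.sem M a) ⊆ A.sem M a := by
  induction A generalizing a with
  | prim p => exact M.closure_closure_subset _
  | times V E att lab ext => exact M.closure_closure_subset _
  | div N V E att lab hole ext ihN =>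
    refine fun r hr b => M.eval_subset_of_eval_subset_of_closure
      (ψ := fun e : Option E => e.elim
        (fun a' => {t | a' = a ∧ t ∈ sem M (div N V E att lab hole ext) a})
        fun d => (lab d).sem M) none ?_ ?_ (ihN b) ?_
    · rintro _ _ ⟨rfl, rfl⟩
      simpa using hr
    · rintro (_ | d) hd
      exacts [absurd rfl hd, rfl]
    · rintro _ ⟨f, ρ, rfl, hρ, rfl⟩
      obtain ⟨ha, hρ'⟩ := hρ none
      exact hρ' _ ⟨f, ρ, rfl, Option.forall.2 ⟨⟨ha, rfl⟩, fun d => hρ (some d)⟩, rfl⟩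

end PreFormula

namespace Formula

variable [Ranked Pr]

/-- The value of a formula in a phase model. -/
def sem (M : PhaseModel Pr U Goal R) : Formula Pr → List U → Set R :=
  Quotient.lift (fun A => A.1.sem M) fun _ _ h => PreFormula.Equiv.sem_eq M h

/-- External nodes are distinct and hole labels have rank at most 1, hereditarily. -/
def IsSimple : Formula Pr → Prop :=
  Quotient.lift (fun A => A.1.IsSimple) fun _ _ h => propext (PreFormula.Equiv.isSimple_iff h)

variable (M : PhaseModel Pr U Goal R)

theorem sem_repr (A : Formula Pr) : A.repr.sem M = A.sem M :=
  congrArg (sem M) (Quotient.out_eq A)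

theorem isSimple_repr (A : Formula Pr) : A.repr.IsSimple ↔ A.IsSimple :=
  iff_of_eq (congrArg IsSimple (Quotient.out_eq A))

theorem closure_sem_subset (A : Formula Pr) (a : List U) : M.closure (A.sem M a) ⊆ A.sem M a :=
  sem_repr M A ▸ A.repr.closure_sem_subset M a

theorem sem_prim (p : Pr) (a : List U) : (prim p).sem M a = M.closure (M.val p a) := rfl

theorem sem_times (G : Hypergraph (Formula Pr)) (a : List U) :
    (times G).sem M a =
      M.closure (eval M.weight G.att G.ext (fun e => (G.lab e).sem M) a) := by
  simp only [← sem_repr M (G.lab _)]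
  rfl

theorem mem_sem_div (N : Formula Pr) (D : HoleGraph (Formula Pr)) (h : Ranked.rk N = D.ext.length)
    {a : List U} {r : R} : r ∈ (div N D h).sem M a ↔ ∀ b,
      eval M.weight (D.fill (div N D h) rfl).att D.ext
        (fun e => e.elim (edgeVal a r) fun d => (D.lab d).sem M) b ⊆ N.sem M b := by
  simp only [← sem_repr M N, ← sem_repr M (D.lab _)]
  rfl

theorem isSimple_times {G : Hypergraph (Formula Pr)} :
    (times G).IsSimple ↔ G.ext.Nodup ∧ ∀ e, (G.lab e).IsSimple := by
  simp only [← isSimple_repr (G.lab _)]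
  rfl

theorem isSimple_div {N : Formula Pr} {D : HoleGraph (Formula Pr)}
    {h : Ranked.rk N = D.ext.length} : (div N D h).IsSimple ↔
      (N.IsSimple ∧ D.ext.Nodup ∧ D.hole.length ≤ 1) ∧ ∀ e, (D.lab e).IsSimple := by
  simp only [← isSimple_repr N, ← isSimple_repr (D.lab _)]
  rfl

end Formula

namespace Hypergraph

/-- The value of a hypergraph in a phase model. -/
def sem {Pr : Type u} [Ranked Pr] {U Goal R : Type*} [AddCommMonoid R]
    (M : PhaseModel Pr U Goal R) (G : Hypergraph (Formula Pr)) : List U → Set R :=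
  eval M.weight G.att G.ext fun e => (G.lab e).sem M

end Hypergraph

namespace Derivable

open HL.Hypergraph

variable {Pr : Type u} [Ranked Pr] {G : Hypergraph (Formula Pr)} {A : Formula Pr}

theorem length_ext (h : Derivable G A) : G.ext.length = Ranked.rk A := by
  induction h with
  | iso hGH _ ih =>
    obtain ⟨σ, τ, -, -, hext⟩ := hGH
    rw [hext, List.length_map, ih]
  | ax A => exact List.length_finRange
  | timesL _ _ _ _ _ _ ih => exact length_ext_replace.symm.trans ih
  | timesR => exact length_ext_replace
  | divL _ _ _ _ _ _ _ _ _ _ ih _ => exact length_ext_replace.trans ih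
  | divR _ _ _ _ hF => exact hF

theorem nodup_ext (h : Derivable G A) (hG : ∀ e, (G.lab e).IsSimple) (hA : A.IsSimple) :
    G.ext.Nodup := by
  induction h with
  | iso hGH _ ih =>
    obtain ⟨σ, τ, -, hlab, hext⟩ := hGH
    rw [hext, List.nodup_map_iff σ.injective]
    exact ih (fun e => hlab e ▸ hG (τ e)) hA
  | ax A => exact List.nodup_finRange _
  | timesL H e M A he _ ih =>
    have hM := Formula.isSimple_times.1 (he ▸ hG e)
    exact .of_map _ (ih (forall_lab_replace.2 ⟨fun d _ => hG d, fun _ => hM.2⟩) hA)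
  | timesR M H hH ih =>
    obtain ⟨hM, hlab⟩ := Formula.isSimple_times.1 hA
    exact (nodup_ext_replace_iff (fun e => (hH e).length_ext.trans (M.rk_lab e)) fun e =>
      ih e ((forall_lab_replace.1 hG).2 e) (hlab e)).2 hM
  | divL H e A N D hD K he _ hK ih ihK =>
    have hDK := forall_lab_replace.1 ((forall_lab_replace.1 hG).2 ())
    have hND : (Formula.div N D hD).IsSimple := hDK.1 none fun d => Option.some_ne_none d
    obtain ⟨⟨hN, hDext, -⟩, hlab⟩ := Formula.isSimple_div.1 hND
    have hDK_nodup : ((D.fill (Formula.div N D hD) rfl).replace .some K).ext.Nodup :=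
      (nodup_ext_replace_iff (fun d => (hK d).length_ext.trans (D.rk_lab d)) fun d =>
        ihK d (hDK.2 d) (hlab d)).2 hDext
    have hlen : ((D.fill (Formula.div N D hD) rfl).replace .some K).ext.length =
        (H.att e).length :=
      length_ext_replace.trans (hD.symm.trans (he ▸ H.rk_lab e))
    exact (nodup_ext_replace_iff (fun _ => hlen) fun _ => hDK_nodup).2
      (ih (forall_lab_of_replace hG fun _ => he ▸ hN) hA)
  | divR F N D hD hF =>
    obtain ⟨⟨-, -, hhole⟩, -⟩ := Formula.isSimple_div.1 hA
    have hlen : F.ext.length ≤ 1 := hF.trans_le hhole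
    rcases hF' : F.ext with _ | ⟨v, _ | ⟨w, l⟩⟩ <;> simp_all

end Derivable

variable {Pr : Type u} [Ranked Pr] {U Goal R : Type*} [AddCommMonoid R]
  (M : PhaseModel Pr U Goal R)

namespace Hypergraph

theorem sem_subset_of_sem_replaceOne_subset {H G : Hypergraph (Formula Pr)} {e : H.E}
    (he : H.lab e = Formula.times G) (hG : G.ext.Nodup) {A : Formula Pr} {a : List U}
    (h : (H.replaceOne e G).sem M a ⊆ A.sem M a) : H.sem M a ⊆ A.sem M a := by
  classical
  refine M.eval_subset_of_eval_subset_of_closure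
    (ψ := Function.update (fun d => (H.lab d).sem M) e (G.sem M)) e
    (fun b => ?_) (fun d hd => Eq.symm (Function.update_of_ne hd ..)) (A.closure_sem_subset M a)
    (subset_trans ?_ h)
  · simp only [he, Formula.sem_times, Function.update_self, sem, subset_refl]
  · have hlen : G.ext.length = (H.att e).length := by
      rw [← H.rk_lab, he]
      rfl
    exact eval_subset_eval_replace (fun _ => hlen) (fun _ => hG)
      (fun _ => (Function.update_self ..).le)
      (fun d => (Function.update_of_ne (d.2 ()).symm ..).le) a

theorem sem_replace_subset {G : Hypergraph (Formula Pr)} {ι : Type} {m : ι ↪ G.E}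
    {H : ι → Hypergraph (Formula Pr)} (hlen : ∀ i, (H i).ext.length = (G.att (m i)).length)
    (hH : ∀ i, (H i).ext.Nodup) (h : ∀ i a, (H i).sem M a ⊆ (G.lab (m i)).sem M a)
    (a : List U) : (G.replace m H).sem M a ⊆ G.sem M a :=
  eval_replace_subset hlen hH h (fun _ => le_rfl) a

end Hypergraph

namespace Formula

variable {N : Formula Pr} {D : HoleGraph (Formula Pr)} {hD : Ranked.rk N = D.ext.length}

theorem sem_fill_div_subset (a : List U) : (D.fill (div N D hD) rfl).sem M a ⊆ N.sem M a := by
  rintro _ ⟨f, ρ, rfl, hρ, rfl⟩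
  exact (mem_sem_div M N D hD).1 (hρ none) _
    ⟨f, ρ, rfl, Option.forall.2 ⟨⟨rfl, rfl⟩, fun d => hρ (some d)⟩, rfl⟩

theorem sem_subset_sem_div {F : Hypergraph (Formula Pr)} (hF : F.ext.length = D.hole.length)
    (hF' : F.ext.Nodup)
    (h : ∀ b, ((D.fill (div N D hD) rfl).replaceOne none F).sem M b ⊆ N.sem M b) (a : List U) :
    F.sem M a ⊆ (div N D hD).sem M a := by
  refine fun r hr => (mem_sem_div M N D hD).2 fun b => subset_trans ?_ (h b)
  refine Hypergraph.eval_subset_eval_replace (fun _ => hF) (fun _ => hF') (fun _ => ?_) ?_ b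
  · rintro _ _ ⟨rfl, rfl⟩
    exact hr
  · rintro ⟨_ | d, hd⟩
    exacts [absurd rfl (hd ()), le_rfl]

end Formula

open HL.Hypergraph in
theorem Derivable.sem_subset {G : Hypergraph (Formula Pr)} {A : Formula Pr} (h : Derivable G A)
    (hG : ∀ e, (G.lab e).IsSimple) (hA : A.IsSimple) (a : List U) : G.sem M a ⊆ A.sem M a := by
  induction h generalizing a with
  | @iso G H A hGH _ ih =>
    obtain ⟨σ, τ, hatt, hlab, hext⟩ := hGH
    have sem_eq : G.sem M = H.sem M :=
      eval_eq_eval_of_equiv σ τ hatt (fun e => by rw [hlab]) hext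
    exact sem_eq ▸ ih (fun e => hlab e ▸ hG (τ e)) hA a
  | ax A => exact fun r hr => (mem_eval_handle.1 hr).2
  | timesL H e G A he _ ih =>
    obtain ⟨hGext, hlab⟩ := Formula.isSimple_times.1 (he ▸ hG e)
    exact sem_subset_of_sem_replaceOne_subset M he hGext
      (ih (forall_lab_replace.2 ⟨fun d _ => hG d, fun _ => hlab⟩) hA a)
  | timesR G H hH ih =>
    obtain ⟨-, hlab⟩ := Formula.isSimple_times.1 hA
    have hHlab := (forall_lab_replace.1 hG).2
    exact (sem_replace_subset M (fun e => (hH e).length_ext.trans (G.rk_lab e))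
      (fun e => (hH e).nodup_ext (hHlab e) (hlab e)) (fun e => ih e (hHlab e) (hlab e)) a).trans
      (Formula.sem_times M G a ▸ M.subset_closure _)
  | divL H e A N D hD K he _ hK ih ihK =>
    have hDK := forall_lab_replace.1 ((forall_lab_replace.1 hG).2 ())
    have hND : (Formula.div N D hD).IsSimple := hDK.1 none fun d => Option.some_ne_none d
    obtain ⟨⟨hN, hDext, -⟩, hlab⟩ := Formula.isSimple_div.1 hND
    have hKlen (d) := (hK d).length_ext.trans (D.rk_lab d)
    have hKext (d) := (hK d).nodup_ext (hDK.2 d) (hlab d)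
    refine (sem_replace_subset M (fun _ => ?_) (fun _ => ?_) (fun _ b => ?_) a).trans
      (ih (forall_lab_of_replace hG fun _ => he ▸ hN) hA a)
    · exact length_ext_replace.trans (hD.symm.trans (he ▸ H.rk_lab e))
    · exact (nodup_ext_replace_iff hKlen hKext).2 hDext
    · exact he ▸ (sem_replace_subset M hKlen hKext (fun d => ihK d (hDK.2 d) (hlab d)) b).trans
        (Formula.sem_fill_div_subset M b)
  | divR F N D hD hF h ih =>
    have hND := Formula.isSimple_div.1 hA
    exact Formula.sem_subset_sem_div M hF (Derivable.nodup_ext (.divR F N D hD hF h) hG hA)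
      (ih (forall_lab_replace.2 ⟨Option.forall.2 ⟨fun h => absurd rfl (h ()), fun d _ => hND.2 d⟩,
        fun _ => hG⟩) hND.1.1) a

end HL

namespace ModeSystem

open HL HL.Hypergraph

variable {Pr : Type u} [Ranked Pr] {S : ModeSystem Pr}

theorem rk_mu (A : S.Fm) : Ranked.rk (S.mu A) = 1 := (S.muAux A).2

section Operations

variable (S) in
/-- The modes and modalities, which are treated uniformly as operations on databases. -/
abbrev Op : Type u := S.I ⊕ S.J

/-- The hyperedge label that represents an operation. -/
def symbol : S.Op → Pr := Sum.elim Subtype.val Subtype.val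

/-- The argument places of an operation. -/
def Child : S.Op → Type
  | .inl _ => Fin 2
  | .inr _ => Unit

instance : (o : S.Op) → Fintype (S.Child o)
  | .inl _ => inferInstanceAs (Fintype (Fin 2))
  | .inr _ => inferInstanceAs (Fintype Unit)

instance : (o : S.Op) → DecidableEq (S.Child o)
  | .inl _ => inferInstanceAs (DecidableEq (Fin 2))
  | .inr _ => inferInstanceAs (DecidableEq Unit)

instance (o : S.Op) : Nonempty (S.Child o) :=
  match o with
  | .inl _ => inferInstanceAs (Nonempty (Fin 2))
  | .inr _ => inferInstanceAs (Nonempty Unit)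

theorem Child.eq_of_ne_of_ne {o : S.Op} {k l l' : S.Child o} (hl : l ≠ k) (hl' : l' ≠ k) :
    l = l' := by
  obtain i | j := o
  · revert k l l'
    exact (by decide : ∀ {k l l' : Fin 2}, l ≠ k → l' ≠ k → l = l')
  · rfl

/-- The commutative modes. -/
def IsComm : S.Op → Prop
  | .inl i => i ∈ S.C
  | .inr _ => False

/-- The nodes `y k` can carry the arguments of `o`: for a commutative mode they coincide, as in
`K^c`. -/
def Compat {U : Type*} (o : S.Op) (y : S.Child o → U) : Prop := S.IsComm o → ∀ k l, y k = y l

open Classical in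
/-- The nodes below the root in the pattern of an operation whose arguments are attached to
the nodes `y k`. -/
noncomputable def lowerNodes {U : Type*} : (o : S.Op) → (S.Child o → U) → List U
  | .inl i, y => if i ∈ S.C then [y (0 : Fin 2)] else [y (0 : Fin 2), y (1 : Fin 2)]
  | .inr _, y => [y ()]

theorem map_lowerNodes {U U' : Type*} (f : U → U') (o : S.Op) (y : S.Child o → U) :
    (lowerNodes o y).map f = lowerNodes o (f ∘ y) := by
  obtain i | j := o
  · simp only [lowerNodes]
    split_ifs <;> rfl
  · rfl

theorem forall_mem_lowerNodes {U : Type*} {o : S.Op} {y : S.Child o → U} (hy : Compat o y)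
    {p : U → Prop} : (∀ u ∈ lowerNodes o y, p u) ↔ ∀ k, p (y k) := by
  obtain i | j := o
  · simp only [lowerNodes]
    split_ifs with hi
    · rw [List.forall_mem_singleton]
      exact ⟨fun h k => hy hi (0 : Fin 2) k ▸ h, fun h => h _⟩
    · rw [List.forall_mem_cons, List.forall_mem_singleton]
      exact (Fin.forall_fin_two (p := fun k => p (y k))).symm
  · rw [lowerNodes, List.forall_mem_singleton]
    exact ⟨fun h _ => h, fun h => h ()⟩

theorem mem_lowerNodes {U : Type*} {o : S.Op} {y : S.Child o → U} (hy : Compat o y) {u : U} :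
    u ∈ lowerNodes o y ↔ ∃ k, y k = u := by
  simpa [eq_comm] using (forall_mem_lowerNodes hy (p := (u ≠ ·))).not

theorem injective_of_nodup {U : Type*} {o : S.Op} {y : S.Child o → U} (ho : ¬ S.IsComm o)
    (h : (lowerNodes o y).Nodup) : Function.Injective y := by
  obtain i | j := o
  · have ne : y (0 : Fin 2) ≠ y (1 : Fin 2) := by simpa [lowerNodes, show i ∉ S.C from ho] using h
    refine fun (k l : Fin 2) hkl => ?_
    fin_cases k <;> fin_cases l <;> first | rfl | exact (ne hkl).elim | exact (ne hkl.symm).elim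
  · exact fun _ _ _ => rfl

theorem lowerNodes_injOn {U : Type*} {o : S.Op} {y z : S.Child o → U} (hy : Compat o y)
    (hz : Compat o z) (h : lowerNodes o y = lowerNodes o z) : y = z := by
  obtain i | j := o
  · by_cases hi : i ∈ S.C
    · have h₀ : y (0 : Fin 2) = z (0 : Fin 2) := by simpa [lowerNodes, hi] using h
      exact funext fun k => (hy hi k (0 : Fin 2)).trans (h₀.trans (hz hi (0 : Fin 2) k))
    · have h₀₁ : y (0 : Fin 2) = z (0 : Fin 2) ∧ y (1 : Fin 2) = z (1 : Fin 2) := by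
        simpa [lowerNodes, hi] using h
      exact funext (Fin.forall_fin_two (p := fun k => y k = z k).2 h₀₁)
  · exact funext fun _ => List.singleton_inj.1 h

theorem rk_symbol {U : Type*} (o : S.Op) (v : U) (y : S.Child o → U) :
    Ranked.rk (symbol o) = (v :: lowerNodes o y).length := by
  obtain i | j := o
  · simp only [lowerNodes]
    split_ifs with hi
    exacts [S.rk_comm i hi, S.rk_mode i hi]
  · exact S.rk_modality j

theorem symbol_injective : Function.Injective (symbol : S.Op → Pr) :=
  Subtype.val_injective.sumElim Subtype.val_injective fun i j h =>
    Set.disjoint_left.1 S.disj i.2 (h ▸ j.2)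

theorem rk_symbol_ne_one (o : S.Op) : Ranked.rk (symbol o) ≠ 1 := by
  obtain i | j := o
  · by_cases hi : i ∈ S.C
    exacts [(S.rk_comm i hi).trans_ne (by simp), (S.rk_mode i hi).trans_ne (by simp)]
  · exact (S.rk_modality j).trans_ne (by simp)

end Operations

section Shapes

/-- A hypergraph in the shape of the pattern of the operation `o`: the hyperedge `edge none` for the
symbol of `o` and, for each argument place `k`, a hyperedge `edge (some k)`. -/
structure Pattern (o : S.Op) {V E : Type} (att : E → List V) (ext : List V) where
  edge : Option (S.Child o) ≃ E
  root : V
  child : S.Child o → V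
  ext_eq : ext = [root]
  att_none : att (edge none) = root :: lowerNodes o child
  att_some : ∀ k, att (edge (some k)) = [child k]
  compat : Compat o child
  nodup : (root :: lowerNodes o child).Nodup
  cover : ∀ v, v ∈ root :: lowerNodes o child

variable {U R : Type*} [AddCommMonoid R]

/-- The value of a hypergraph in the shape of the pattern of `o`, given the values of the hyperedge
for the symbol and of the hyperedges for the arguments. -/
def patternVal (ν : U → R) (o : S.Op) (φ₀ : List U → Set R) (φ : S.Child o → U → Set R)
    (a : List U) : Set R :=
  {r | ∃ (v : U) (y : S.Child o → U) (ρ₀ : R) (ρ : S.Child o → R), Compat o y ∧ a = [v] ∧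
    ρ₀ ∈ φ₀ (v :: lowerNodes o y) ∧ (∀ k, ρ k ∈ φ k (y k)) ∧
    r = ρ₀ + ∑ k, ρ k + ((lowerNodes o y).map ν).sum}

theorem patternVal_subset {U R : Type*} [AddCommMonoid R] {ν : U → R} {o : S.Op}
    {φ₀ φ₀' : List U → Set R} {φ φ' : S.Child o → U → Set R}
    (h₀ : ∀ b : List U, b.length = Ranked.rk (symbol o) → φ₀ b ⊆ φ₀' b)
    (h : ∀ k u, φ k u ⊆ φ' k u) (a : List U) : patternVal ν o φ₀ φ a ⊆ patternVal ν o φ₀' φ' a := by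
  rintro _ ⟨v, y, ρ₀, ρ, hy, rfl, hρ₀, hρ, rfl⟩
  exact ⟨v, y, ρ₀, ρ, hy, rfl, h₀ _ (rk_symbol o v y).symm hρ₀, fun k => h k _ (hρ k), rfl⟩

namespace Pattern

variable {o : S.Op} {V E : Type} {att : E → List V} {ext : List V} (s : Pattern o att ext)

theorem exists_placement (s : Pattern o att ext) (v : U) {y : S.Child o → U} (hy : Compat o y) :
    ∃ f : V → U, f s.root = v ∧ f ∘ s.child = y := by
  classical
  have child_ne (k) : s.child k ≠ s.root := fun h =>
    (List.nodup_cons.1 s.nodup).1 ((mem_lowerNodes s.compat).2 ⟨k, h⟩)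
  have y_eq {k l} (h : s.child k = s.child l) : y k = y l := by
    by_cases ho : S.IsComm o
    · exact hy ho k l
    · exact congrArg y (injective_of_nodup ho s.nodup.of_cons h)
  refine ⟨fun w => if h : ∃ k, s.child k = w then y h.choose else v, ?_, funext fun k => ?_⟩
  · exact dif_neg fun ⟨k, hk⟩ => child_ne k hk
  · have h : ∃ l, s.child l = s.child k := ⟨k, rfl⟩
    exact (dif_pos h).trans (y_eq h.choose_spec)

theorem finsum_inner (x : V → R) :
    ∑ᶠ v : {v // v ∉ ext}, x v = ((lowerNodes o s.child).map x).sum := by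
  classical
  have mem_iff (v) : v ∉ ext ↔ v ∈ (lowerNodes o s.child).toFinset := by
    have root_notMem := (List.nodup_cons.1 s.nodup).1
    have mem_ext : v ∈ ext ↔ v = s.root :=
      (iff_of_eq (congrArg (v ∈ ·) s.ext_eq)).trans List.mem_singleton
    rw [mem_ext, List.mem_toFinset]
    refine ⟨fun h => (List.mem_cons.1 (s.cover v)).resolve_left h, ?_⟩
    rintro h rfl
    exact root_notMem h
  rw [← List.sum_toFinset x s.nodup.of_cons, ← finsum_mem_coe_finset,
    ← finsum_set_coe_eq_finsum_mem]
  exact finsum_comp_equiv (Equiv.subtypeEquivRight mem_iff) (f := fun v => x v)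

theorem eval_eq [Finite E] (ν : U → R) (φ : E → List U → Set R) (a : List U) :
    eval ν att ext φ a =
      patternVal ν o (φ (s.edge none)) (fun k u => φ (s.edge (some k)) [u]) a := by
  have sum_eq (ρ : E → R) : ∑ᶠ e, ρ e = ρ (s.edge none) + ∑ k, ρ (s.edge (some k)) := by
    rw [← finsum_comp_equiv s.edge, finsum_optionType, finsum_eq_sum_of_fintype]
  have inner_eq (f : V → U) : ∑ᶠ v : {v // v ∉ ext}, ν (f v) =
      ((lowerNodes o (f ∘ s.child)).map ν).sum := by
    rw [s.finsum_inner (fun v => ν (f v)), ← map_lowerNodes, List.map_map]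
    rfl
  refine Set.Subset.antisymm ?_ ?_
  · rintro _ ⟨f, ρ, rfl, hρ, rfl⟩
    refine ⟨f s.root, f ∘ s.child, _, fun k => ρ (s.edge (some k)),
      fun ho k l => congrArg f (s.compat ho k l), by simp [s.ext_eq], ?_, fun k => ?_,
      by rw [sum_eq, inner_eq]⟩
    · have := hρ (s.edge none)
      rwa [s.att_none, List.map_cons, map_lowerNodes] at this
    · simpa [s.att_some] using hρ (s.edge (some k))
  · rintro _ ⟨v, y, ρ₀, ρ, hy, rfl, hρ₀, hρ, rfl⟩
    obtain ⟨f, rfl, rfl⟩ := s.exists_placement v hy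
    refine ⟨f, fun e => (s.edge.symm e).elim ρ₀ ρ, by simp [s.ext_eq],
      s.edge.forall_congr_right.1 (Option.forall.2 ⟨?_, fun k => ?_⟩), ?_⟩
    · simpa [s.att_none, map_lowerNodes] using hρ₀
    · simpa [s.att_some] using hρ k
    · simp [sum_eq, inner_eq]

theorem nodup_ext (s : Pattern o att ext) : ext.Nodup :=
  s.ext_eq ▸ List.nodup_singleton s.root

theorem length_att_edge (k : S.Child o) : (att (s.edge (some k))).length = 1 := by
  rw [s.att_some, List.length_singleton]

end Pattern

end Shapes

section Induction

/-- The structured database with operation `o` and immediate components `X k`. -/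
def node : (o : S.Op) → (S.Child o → S.Db) → S.Db
  | .inl i, X => .pair i (X (0 : Fin 2)) (X (1 : Fin 2))
  | .inr j, X => .bracket j (X ())

/-- The product `A 0 •_o A 1`, respectively `◇_o (A ())`. -/
def prod : (o : S.Op) → (S.Child o → S.Fm) → S.Fm
  | .inl i, A => .prod i (A (0 : Fin 2)) (A (1 : Fin 2))
  | .inr j, A => .dia j (A ())

/-- The residual of the operation `o` in the argument place `k`. Only the `B l` with `l ≠ k`
matter. -/
def residual : (o : S.Op) → S.Child o → (S.Child o → S.Fm) → S.Fm → S.Fm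
  | .inl i, (0 : Fin 2), B, A => .rdiv i A (B (1 : Fin 2))
  | .inl i, (1 : Fin 2), B, A => .ldiv i (B (0 : Fin 2)) A
  | .inr j, _, _, A => .box j A

@[elab_as_elim]
theorem db_induction {motive : S.Db → Prop} (form : ∀ A, motive (.form A))
    (node : ∀ o X, (∀ k, motive (X k)) → motive (node o X)) (X : S.Db) : motive X := by
  induction X with
  | form A => exact form A
  | pair i X Y hX hY => exact node (.inl i) (![X, Y] : Fin 2 → S.Db) (Fin.forall_fin_two.2 ⟨hX, hY⟩)
  | bracket j X hX => exact node (.inr j) (fun _ => X) fun _ => hX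

@[elab_as_elim]
theorem fm_induction {motive : S.Fm → Prop} (prim : ∀ p, motive (.prim p))
    (prod : ∀ o A, (∀ k, motive (A k)) → motive (prod o A))
    (residual : ∀ o k B A, (∀ l, motive (B l)) → motive A → motive (residual o k B A))
    (A : S.Fm) : motive A := by
  induction A with
  | prim p => exact prim p
  | prod i A B hA hB =>
    exact prod (.inl i) (![A, B] : Fin 2 → S.Fm) (Fin.forall_fin_two.2 ⟨hA, hB⟩)
  | ldiv i B A hB hA => exact residual (.inl i) (1 : Fin 2) (fun _ => B) A (fun _ => hB) hA
  | rdiv i A B hA hB => exact residual (.inl i) (0 : Fin 2) (fun _ => B) A (fun _ => hB) hA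
  | dia j A hA => exact prod (.inr j) (fun _ => A) fun _ => hA
  | box j A hA => exact residual (.inr j) () (fun _ => A) A (fun _ => hA) hA

end Induction

section Patterns

/-- The shape of `R^i`. -/
noncomputable def Pattern.ofMode {i : S.I} (hi : i ∉ S.C) {E : Type} {att : E → List (Fin 3)}
    (edge : Option (Fin 2) ≃ E) (h₀ : att (edge none) = [0, 1, 2])
    (h : ∀ k, att (edge (some k)) = [k.succ]) : Pattern (.inl i : S.Op) att [0] where
  edge := edge
  root := 0
  child := Fin.succ (n := 2)
  ext_eq := rfl
  att_none := h₀.trans (by simp [lowerNodes, hi])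
  att_some := h
  compat := fun ho => absurd ho hi
  nodup := by simp [lowerNodes, hi]
  cover := by simp [lowerNodes, hi, Fin.forall_fin_succ]

/-- The shape of `K^c`. -/
noncomputable def Pattern.ofComm {i : S.I} (hi : i ∈ S.C) {E : Type} {att : E → List (Fin 2)}
    (edge : Option (Fin 2) ≃ E) (h₀ : att (edge none) = [0, 1])
    (h : ∀ k, att (edge (some k)) = [1]) : Pattern (.inl i : S.Op) att [0] where
  edge := edge
  root := 0
  child := fun _ => 1
  ext_eq := rfl
  att_none := h₀.trans (by simp [lowerNodes, hi])
  att_some := h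
  compat := fun _ _ _ => rfl
  nodup := by simp [lowerNodes, hi]
  cover := by simp [lowerNodes, hi, Fin.forall_fin_succ]

/-- The shape of `U^j`. -/
noncomputable def Pattern.ofModality (j : S.J) {E : Type} {att : E → List (Fin 2)}
    (edge : Option Unit ≃ E) (h₀ : att (edge none) = [0, 1])
    (h : att (edge (some ())) = [1]) : Pattern (.inr j : S.Op) att [0] where
  edge := edge
  root := 0
  child := fun _ => 1
  ext_eq := rfl
  att_none := h₀
  att_some := fun _ => h
  compat := fun _ _ _ => rfl
  nodup := by simp [lowerNodes]
  cover := by simp [lowerNodes, Fin.forall_fin_succ]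

variable {L : Type v} [Ranked L] {a : L}

/-- The shape of `R^i`, with the edges `r₀`, `r₁`, `r₂`. -/
noncomputable def patternR {i : S.I} (hi : i ∉ S.C) {A B : L} (ha : Ranked.rk a = 3)
    (hA : Ranked.rk A = 1) (hB : Ranked.rk B = 1) :
    Pattern (.inl i : S.Op) (R a A B ha hA hB).att (R a A B ha hA hB).ext :=
  .ofMode hi (finSuccEquiv 2).symm rfl (Fin.forall_fin_two.2 ⟨rfl, rfl⟩)

/-- The shape of `K^c`, with the edges `k₀`, `k₁`, `k₂`. -/
noncomputable def patternK {c : S.I} (hc : c ∈ S.C) {A B : L} (ha : Ranked.rk a = 2)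
    (hA : Ranked.rk A = 1) (hB : Ranked.rk B = 1) :
    Pattern (.inl c : S.Op) (K a A B ha hA hB).att (K a A B ha hA hB).ext :=
  .ofComm hc (finSuccEquiv 2).symm rfl (Fin.forall_fin_two.2 ⟨rfl, rfl⟩)

/-- The hyperedges of the pattern of a modality. -/
noncomputable def unaryEquiv : Option Unit ≃ Fin 2 :=
  Equiv.ofBijective (fun e => e.elim 0 fun _ => 1) (by decide)

/-- The shape of `U^j`, with the edges `u₀`, `u₁`. -/
noncomputable def patternU (j : S.J) {A : L} (ha : Ranked.rk a = 2) (hA : Ranked.rk A = 1) :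
    Pattern (.inr j : S.Op) (U a A ha hA).att (U a A ha hA).ext :=
  .ofModality j unaryEquiv rfl rfl

theorem exists_mu_prod_eq (o : S.Op) (A : S.Child o → S.Fm) :
    ∃ (G : HL.Hypergraph (Formula Pr)) (s : Pattern o G.att G.ext), S.mu (prod o A) = .times G ∧
      G.lab (s.edge none) = .prim (symbol o) ∧ ∀ k, G.lab (s.edge (some k)) = S.mu (A k) := by
  obtain i | j := o
  · have h₀ := rk_mu (A (0 : Fin 2))
    have h₁ := rk_mu (A (1 : Fin 2))
    by_cases hi : i ∈ S.C
    · exact ⟨_, patternK (a := .prim i.1) hi (S.rk_comm i hi) h₀ h₁, by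
        rw [mu, prod, muAux, dif_pos hi]; rfl, rfl, Fin.forall_fin_two.2 ⟨rfl, rfl⟩⟩
    · exact ⟨_, patternR (a := .prim i.1) hi (S.rk_mode i hi) h₀ h₁, by
        rw [mu, prod, muAux, dif_neg hi]; rfl, rfl, Fin.forall_fin_two.2 ⟨rfl, rfl⟩⟩
  · exact ⟨_, patternU (a := .prim j.1) j (S.rk_modality j) (rk_mu (A ())), rfl, rfl, fun _ => rfl⟩

theorem exists_htree_node_eq (o : S.Op) (X : S.Child o → S.Db) :
    ∃ (G : HL.Hypergraph (Formula Pr)) (s : Pattern o G.att G.ext) (m : S.Child o ↪ G.E),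
      S.htree (node o X) = G.replace m (fun k => S.htree (X k)) ∧
      G.lab (s.edge none) = .prim (symbol o) ∧ ∀ k, s.edge (some k) = m k := by
  have vec_eq (X : Fin 2 → S.Db) : ![S.htree (X 0), S.htree (X 1)] = fun k => S.htree (X k) :=
    funext (Fin.forall_fin_two.2 ⟨rfl, rfl⟩)
  obtain i | j := o
  · by_cases hi : i ∈ S.C
    · exact ⟨_, patternK (a := .prim i.1) hi (S.rk_comm i hi) (dummy Pr).2 (dummy Pr).2,
        Fin.succEmb 2, (dif_pos hi).trans (congrArg _ (vec_eq X)), rfl, fun _ => rfl⟩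
    · exact ⟨_, patternR (a := .prim i.1) hi (S.rk_mode i hi) (dummy Pr).2 (dummy Pr).2,
        Fin.succEmb 2, (dif_neg hi).trans (congrArg _ (vec_eq X)), rfl, fun _ => rfl⟩
  · exact ⟨_, patternU (a := .prim j.1) j (S.rk_modality j) (dummy Pr).2, _, rfl, rfl, fun _ => rfl⟩

/-- The hyperedges of a pattern of a mode in which the second argument is the hole. -/
noncomputable def holeRightEquiv : Option (Fin 2) ≃ Option (Fin 2) :=
  Equiv.ofBijective (fun e => e.elim (some 0) ![some 1, none]) (by decide)

/-- The hyperedges of a pattern of a mode in which the first argument is the hole. -/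
noncomputable def holeLeftEquiv : Option (Fin 2) ≃ Option (Fin 2) :=
  Equiv.ofBijective (fun e => e.elim (some 0) ![none, some 1]) (by decide)

/-- The hyperedges of a pattern of a modality in which the argument is the hole. -/
noncomputable def holeUnaryEquiv : Option Unit ≃ Option (Fin 1) :=
  Equiv.ofBijective (fun e => e.elim (some 0) fun _ => none) (by decide)

theorem exists_mu_residual_eq (o : S.Op) (k : S.Child o) (B : S.Child o → S.Fm) (A : S.Fm) :
    ∃ (D : HoleGraph (Formula Pr)) (h : Ranked.rk (S.mu A) = D.ext.length)
      (s : Pattern o (fun e : Option D.E => e.elim D.hole D.att) D.ext),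
      S.mu (residual o k B A) = .div (S.mu A) D h ∧ s.edge (some k) = none ∧
      (∃ e, s.edge none = some e ∧ D.lab e = .prim (symbol o)) ∧
      ∀ l ≠ k, ∃ e, s.edge (some l) = some e ∧ D.lab e = S.mu (B l) := by
  have hA := rk_mu A
  obtain i | j := o
  · have h₀ := rk_mu (B (0 : Fin 2))
    have h₁ := rk_mu (B (1 : Fin 2))
    have forall_ne {p : Fin 2 → Prop} : (p 1 → ∀ l ≠ 0, p l) ∧ (p 0 → ∀ l ≠ 1, p l) := by
      simp [Fin.forall_fin_two]
    by_cases hi : i ∈ S.C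
    · revert k
      refine Fin.forall_fin_two.2 ⟨?_, ?_⟩
      · exact ⟨KHole _ _ (S.rk_comm i hi) h₁, hA, .ofComm hi holeLeftEquiv rfl
          (Fin.forall_fin_two.2 ⟨rfl, rfl⟩), congrArg Subtype.val (dif_pos hi), rfl,
          ⟨_, rfl, rfl⟩, forall_ne.1 ⟨_, rfl, rfl⟩⟩
      · exact ⟨KHole _ _ (S.rk_comm i hi) h₀, hA, .ofComm hi holeRightEquiv rfl
          (Fin.forall_fin_two.2 ⟨rfl, rfl⟩), congrArg Subtype.val (dif_pos hi), rfl,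
          ⟨_, rfl, rfl⟩, forall_ne.2 ⟨_, rfl, rfl⟩⟩
    · revert k
      refine Fin.forall_fin_two.2 ⟨?_, ?_⟩
      · exact ⟨RHoleLeft _ _ (S.rk_mode i hi) h₁, hA, .ofMode hi holeLeftEquiv rfl
          (Fin.forall_fin_two.2 ⟨rfl, rfl⟩), congrArg Subtype.val (dif_neg hi), rfl,
          ⟨_, rfl, rfl⟩, forall_ne.1 ⟨_, rfl, rfl⟩⟩
      · exact ⟨RHoleRight _ _ (S.rk_mode i hi) h₀, hA, .ofMode hi holeRightEquiv rfl
          (Fin.forall_fin_two.2 ⟨rfl, rfl⟩), congrArg Subtype.val (dif_neg hi), rfl,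
          ⟨_, rfl, rfl⟩, forall_ne.2 ⟨_, rfl, rfl⟩⟩
  · exact ⟨UHole _ (S.rk_modality j), hA, .ofModality j holeUnaryEquiv rfl rfl, rfl, rfl,
      ⟨_, rfl, rfl⟩, fun l hl => (hl rfl).elim⟩

end Patterns

section Semantics

variable {U Goal R : Type*} [AddCommMonoid R] (M : PhaseModel Pr U Goal R)

theorem sem_mu_prod (o : S.Op) (A : S.Child o → S.Fm) (a : List U) :
    (S.mu (prod o A)).sem M a = M.closure (patternVal M.weight o ((Formula.prim (symbol o)).sem M)
      (fun k u => (S.mu (A k)).sem M [u]) a) := by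
  obtain ⟨G, s, hG, h₀, h⟩ := exists_mu_prod_eq o A
  simp only [hG, Formula.sem_times, s.eval_eq, h₀, h]

open Classical in
theorem mem_sem_mu_residual {o : S.Op} {k : S.Child o} {B : S.Child o → S.Fm} {A : S.Fm} {r : R}
    {u : U} : r ∈ (S.mu (residual o k B A)).sem M [u] ↔ ∀ b,
      patternVal M.weight o ((Formula.prim (symbol o)).sem M)
        (fun l w => if l = k then edgeVal [u] r [w] else (S.mu (B l)).sem M [w]) b ⊆
      (S.mu A).sem M b := by
  obtain ⟨D, h, s, hD, hk, ⟨d, hd, hd₀⟩, hne⟩ := exists_mu_residual_eq o k B A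
  rw [hD, Formula.mem_sem_div]
  refine forall_congr' fun b => Eq.to_iff ?_
  congr 1
  refine (s.eval_eq M.weight _ b).trans ?_
  congr 1
  · rw [hd]
    exact congrArg (Formula.sem M) hd₀
  · funext l w
    split_ifs with hl
    · rw [hl, hk]
      rfl
    · obtain ⟨e, he, he'⟩ := hne l hl
      rw [he]
      exact congrFun (congrArg (Formula.sem M) he') _

end Semantics

theorem isSimple_mu (A : S.Fm) : (S.mu A).IsSimple := by
  induction A using fm_induction with
  | prim => trivial
  | prod o A hA =>
    obtain ⟨G, s, hG, h₀, h⟩ := exists_mu_prod_eq o A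
    rw [hG, Formula.isSimple_times, s.ext_eq, s.edge.forall_congr_right.symm, Option.forall]
    exact ⟨List.nodup_singleton _, h₀ ▸ trivial, fun k => (h k).symm ▸ hA k⟩
  | residual o k B A hB hA =>
    obtain ⟨D, h, s, hD, hk, ⟨d, hd, hd₀⟩, hne⟩ := exists_mu_residual_eq o k B A
    have hole_eq := s.att_some k
    rw [hk] at hole_eq
    rw [hD, Formula.isSimple_div, s.ext_eq]
    refine ⟨⟨hA, List.nodup_singleton _, (congrArg List.length hole_eq).le⟩, fun e => ?_⟩
    obtain ⟨_ | l, hl⟩ := s.edge.surjective (some e)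
    · rw [← Option.some.inj (hd.symm.trans hl), hd₀]
      trivial
    · obtain ⟨e', he', hlab⟩ := hne l (by rintro rfl; cases hk.symm.trans hl)
      rw [← Option.some.inj (he'.symm.trans hl), hlab]
      exact hB l

theorem length_ext_htree (X : S.Db) : (S.htree X).ext.length = 1 := by
  induction X using db_induction with
  | form A => exact List.length_finRange.trans (rk_mu A)
  | node o X _ =>
    obtain ⟨G, s, m, hG, -, -⟩ := exists_htree_node_eq o X
    rw [hG, length_ext_replace, s.ext_eq, List.length_singleton]

theorem nodup_ext_htree (X : S.Db) : (S.htree X).ext.Nodup :=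
  nodup_of_length_eq_one (length_ext_htree X)

theorem images_htree_node {U : Type*} (o : S.Op) (X : S.Child o → S.Db) :
    (S.htree (node o X)).images = patternVal (nodeConfig (L := Formula Pr) (U := U)) o
      (edgeConfig (.prim (symbol o))) (fun k u => (S.htree (X k)).images [u]) := by
  obtain ⟨G, s, m, hG, h₀, hm⟩ := exists_htree_node_eq o X
  have hlen (k) : (S.htree (X k)).ext.length = (G.att (m k)).length := by
    rw [length_ext_htree, ← hm, Pattern.length_att_edge]
  have none_notMem : ¬ ∃ k, m k = s.edge none := fun ⟨k, hk⟩ =>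
    Option.some_ne_none k (s.edge.injective ((hm k).trans hk))
  rw [hG, images_replace hlen fun k => nodup_ext_htree _]
  funext a
  simp only [s.eval_eq, hm, m.injective.extend_apply, Function.extend_apply' _ _ _ none_notMem, h₀]

section Derivations

variable (S) in
/-- The structured databases with one distinguished place. -/
abbrev DbCtx : Type u := NLM.Ctx {p : Pr // Ranked.rk p = 1} S.I S.J

/-- Derivability in the multimodal Lambek calculus without associative modes. -/
abbrev Der (X : S.Db) (T : S.Fm) : Prop := NLM.Derivable S.C ∅ X T

/-- The context in which the distinguished place is the one of `Δ`, inside the component `k` of a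
database with operation `o`. Only the `X l` with `l ≠ k` matter. -/
def nodeCtx : (o : S.Op) → (S.Child o → S.Db) → S.Child o → S.DbCtx → S.DbCtx
  | .inl i, X, (0 : Fin 2), Δ => .pairLeft i Δ (X (1 : Fin 2))
  | .inl i, X, (1 : Fin 2), Δ => .pairRight i (X (0 : Fin 2)) Δ
  | .inr j, _, _, Δ => .bracket j Δ

theorem plug_nodeCtx (o : S.Op) (X : S.Child o → S.Db) (k : S.Child o) (Δ : S.DbCtx) (Z : S.Db) :
    (nodeCtx o X k Δ).plug Z = node o (Function.update X k (Δ.plug Z)) := by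
  obtain i | j := o
  · revert k
    exact Fin.forall_fin_two.2 ⟨rfl, rfl⟩
  · rfl

@[elab_as_elim]
theorem ctx_induction [Nonempty S.Db] {motive : S.DbCtx → Prop} (hole : motive .hole)
    (nodeCtx : ∀ o X k Δ, motive Δ → motive (nodeCtx o X k Δ)) (Δ : S.DbCtx) : motive Δ := by
  induction Δ with
  | hole => exact hole
  | pairLeft i Δ Y hΔ => exact nodeCtx (.inl i) (fun _ => Y) (0 : Fin 2) Δ hΔ
  | pairRight i X Δ hΔ => exact nodeCtx (.inl i) (fun _ => X) (1 : Fin 2) Δ hΔ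
  | bracket j Δ hΔ => exact nodeCtx (.inr j) (fun _ => Classical.arbitrary _) () Δ hΔ

variable {o : S.Op} {Δ : S.DbCtx} {X : S.Child o → S.Db} {A T : S.Fm}

theorem Der.prodL {A : S.Child o → S.Fm} (h : Der (Δ.plug (node o fun k => .form (A k))) T) :
    Der (Δ.plug (.form (prod o A))) T := by
  obtain i | j := o
  exacts [.prodL _ _ _ _ _ h, .diaL _ _ _ _ h]

theorem Der.prodR {A : S.Child o → S.Fm} (h : ∀ k, Der (X k) (A k)) :
    Der (node o X) (prod o A) := by
  obtain i | j := o
  exacts [.prodR _ _ _ _ _ (h (0 : Fin 2)) (h (1 : Fin 2)), .diaR _ _ _ (h ())]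

theorem Der.residualL (k : S.Child o) {B : S.Child o → S.Fm} (hΔ : Der (Δ.plug (.form A)) T)
    (hk : X k = .form (residual o k B A)) (h : ∀ l ≠ k, Der (X l) (B l)) :
    Der (Δ.plug (node o X)) T := by
  obtain i | j := o
  · revert k
    refine Fin.forall_fin_two.2 ⟨fun hk h => ?_, fun hk h => ?_⟩
    · rw [node, hk]
      exact .rdivL _ _ _ _ _ _ hΔ (h (1 : Fin 2) (one_ne_zero (α := Fin 2)))
    · rw [node, hk]
      exact .ldivL _ _ _ _ _ _ hΔ (h (0 : Fin 2) (zero_ne_one (α := Fin 2)))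
  · rw [node, show X () = _ from hk]
    exact .boxL _ _ _ _ hΔ

theorem Der.residualR (k : S.Child o) {B : S.Child o → S.Fm} (hX : Der (node o X) A)
    (h : ∀ l ≠ k, X l = .form (B l)) : Der (X k) (residual o k B A) := by
  obtain i | j := o
  · revert k
    refine Fin.forall_fin_two.2 ⟨fun h => ?_, fun h => ?_⟩
    · rw [node, h (1 : Fin 2) (one_ne_zero (α := Fin 2))] at hX
      exact .rdivR _ _ _ _ hX
    · rw [node, h (0 : Fin 2) (zero_ne_one (α := Fin 2))] at hX
      exact .ldivR _ _ _ _ hX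
  · exact .boxR _ _ _ hX

/-- `X` can be replaced by `Y` in the antecedent of every derivable sequent. -/
def Le (X Y : S.Db) : Prop := ∀ (Δ : S.DbCtx) T, Der (Δ.plug X) T → Der (Δ.plug Y) T

theorem exists_plug_eq_plug_plug (Δ Δ' : S.DbCtx) :
    ∃ Θ : S.DbCtx, ∀ Z, Θ.plug Z = Δ.plug (Δ'.plug Z) := by
  induction Δ with
  | hole => exact ⟨Δ', fun _ => rfl⟩
  | pairLeft i Δ Y ih =>
    obtain ⟨Θ, hΘ⟩ := ih
    exact ⟨.pairLeft i Θ Y, fun Z => congrArg (NLM.Database.pair i · Y) (hΘ Z)⟩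
  | pairRight i X Δ ih =>
    obtain ⟨Θ, hΘ⟩ := ih
    exact ⟨.pairRight i X Θ, fun Z => congrArg (NLM.Database.pair i X) (hΘ Z)⟩
  | bracket j Δ ih =>
    obtain ⟨Θ, hΘ⟩ := ih
    exact ⟨.bracket j Θ, fun Z => congrArg (NLM.Database.bracket j) (hΘ Z)⟩

theorem le_update {Y : S.Db} {k : S.Child o} (h : Le (X k) Y) :
    Le (node o X) (node o (Function.update X k Y)) := fun Δ T hX => by
  obtain ⟨Θ, hΘ⟩ := exists_plug_eq_plug_plug Δ (nodeCtx o X k .hole)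
  have plug_eq (Z) : Θ.plug Z = Δ.plug (node o (Function.update X k Z)) := by
    rw [hΘ, plug_nodeCtx]
    rfl
  rw [← plug_eq]
  refine h Θ T ?_
  rwa [plug_eq, Function.update_eq_self]

theorem le_node {Y : S.Child o → S.Db} (h : ∀ k, Le (X k) (Y k)) :
    Le (node o X) (node o Y) := by
  have le_piecewise (s : Finset (S.Child o)) : Le (node o X) (node o (s.piecewise Y X)) := by
    induction s using Finset.induction_on with
    | empty => exact fun _ _ h => h
    | insert k s hk ih =>
      intro Δ T hX
      rw [Finset.piecewise_insert]
      refine le_update ?_ Δ T (ih Δ T hX)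
      rw [Finset.piecewise_eq_of_notMem _ _ _ hk]
      exact h k
  simpa using le_piecewise Finset.univ

theorem le_node_comp {σ : Equiv.Perm (S.Child o)} (h : S.IsComm o ∨ σ = 1) :
    Le (node o (X ∘ σ)) (node o X) := by
  by_cases hσ : σ = 1
  · exact hσ ▸ fun _ _ h => h
  · obtain i | j := o
    · have eq_swap : ∀ τ : Equiv.Perm (Fin 2), τ ≠ 1 → τ = Equiv.swap 0 1 := by decide
      obtain rfl := eq_swap σ hσ
      exact fun Δ T hX => .perm Δ i _ _ T (h.resolve_right hσ) hX
    · exact (hσ (Equiv.ext fun _ => rfl)).elim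

end Derivations

section Trees

variable {U : Type*}

/-- A hyperedge of a translated database, with nodes in `U`: a formula `A` at a node `v`, or the
symbol of an operation `o` at a node `v` and the nodes `l` below it. -/
inductive Item (S : ModeSystem Pr) (U : Type*)
  | leaf (A : S.Fm) (v : U)
  | op (o : S.Op) (v : U) (l : List U)

namespace Item

/-- The upper node of an item. -/
def head : Item S U → U
  | leaf _ v => v
  | op _ v _ => v

/-- The lower nodes of an item. -/
def tail : Item S U → List U
  | leaf _ _ => []
  | op _ _ l => l

/-- The lower nodes of a multiset of items. -/
def tails : Multiset (Item S U) →+ Multiset U :=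
  Multiset.sumAddMonoidHom.comp (Multiset.mapAddMonoidHom fun i => (i.tail : Multiset U))

theorem tails_singleton (i : Item S U) : tails {i} = i.tail := by
  simp [tails]

theorem tails_cons (i : Item S U) (r : Multiset (Item S U)) :
    tails (i ::ₘ r) = i.tail + tails r := by
  rw [← Multiset.singleton_add, map_add, tails_singleton]

theorem tails_leaf_add (A : S.Fm) (v : U) (r : Multiset (Item S U)) :
    tails ({.leaf A v} + r) = tails r := by
  rw [map_add, tails_singleton]
  exact zero_add _

theorem tail_le_tails {i : Item S U} {r : Multiset (Item S U)} (h : i ∈ r) :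
    (i.tail : Multiset U) ≤ tails r := by
  obtain ⟨r, rfl⟩ := Multiset.exists_cons_of_mem h
  exact tails_cons i r ▸ Multiset.le_add_right _ _

end Item

open Item

/-- `IsTree p r X` says that the items `r` form the translation of the database `X`, with root
item `p`. -/
inductive IsTree : Item S U → Multiset (Item S U) → S.Db → Prop
  | leaf (A : S.Fm) (v : U) : IsTree (.leaf A v) {.leaf A v} (.form A)
  | op (o : S.Op) (v : U) (q : S.Child o → Item S U) (r : S.Child o → Multiset (Item S U))
      (X : S.Child o → S.Db) (compat : Compat o (head ∘ q)) (h : ∀ k, IsTree (q k) (r k) (X k)) :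
      IsTree (.op o v (lowerNodes o (head ∘ q)))
        (.op o v (lowerNodes o (head ∘ q)) ::ₘ ∑ k, r k) (node o X)

open Classical in
/-- The items that can hang below an operation in a tree with items from `t` are determined by the
nodes below the operation. -/
def Deterministic (t : Multiset (Item S U)) : Prop :=
  ∀ o v l, Item.op o v l ∈ t →
    l.Nodup ∧ (t.countP fun i => i.head ∈ l) ≤ Fintype.card (S.Child o)

namespace IsTree

variable {p : Item S U} {r t : Multiset (Item S U)} {X : S.Db}

theorem eq_of_leaf {A : S.Fm} {v : U} (h : IsTree (.leaf A v) r X) :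
    r = {.leaf A v} ∧ X = .form A := by
  cases h
  exact ⟨rfl, rfl⟩

theorem exists_of_op {o : S.Op} {v : U} {l : List U} (h : IsTree (.op o v l) r X) :
    ∃ (q : S.Child o → Item S U) (s : S.Child o → Multiset (Item S U)) (Y : S.Child o → S.Db),
      Compat o (head ∘ q) ∧ l = lowerNodes o (head ∘ q) ∧ (∀ k, IsTree (q k) (s k) (Y k)) ∧
      r = .op o v l ::ₘ ∑ k, s k ∧ X = node o Y := by
  cases h with
  | op _ _ q s Y hq h => exact ⟨q, s, Y, hq, rfl, h, rfl, rfl⟩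

theorem exists_cons (h : IsTree p r X) : ∃ r', r = p ::ₘ r' ∧ ∀ i ∈ r', i.head ∈ tails r := by
  induction h with
  | leaf A v => exact ⟨0, rfl, fun _ h => (Multiset.notMem_zero _ h).elim⟩
  | op o v q r _ hq _ ih =>
    refine ⟨_, rfl, fun i hi => ?_⟩
    obtain ⟨k, -, hi⟩ := Multiset.mem_sum.1 hi
    obtain ⟨r', hr, hr'⟩ := ih k
    rw [tails_cons, Multiset.mem_add, map_sum, Multiset.mem_sum]
    rw [hr, Multiset.mem_cons] at hi
    refine hi.imp ?_ fun hi => ⟨k, Finset.mem_univ k, hr' i hi⟩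
    rintro rfl
    exact (mem_lowerNodes hq).2 ⟨k, rfl⟩

theorem head_mem (h : IsTree p r X) {i : Item S U} (hi : i ∈ r) : i.head ∈ p.head ::ₘ tails r := by
  obtain ⟨r', hr, hr'⟩ := h.exists_cons
  rw [hr, Multiset.mem_cons] at hi
  exact Multiset.mem_cons.2 (hi.imp (congrArg head) (hr' i))

theorem root_mem (h : IsTree p r X) : p ∈ r := by
  obtain ⟨r', rfl, -⟩ := h.exists_cons
  exact Multiset.mem_cons_self p r'

theorem eq_root (h : IsTree p r X) (hr : (p.head ::ₘ tails r).Nodup) {i : Item S U} (hi : i ∈ r)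
    (hip : i.head = p.head) : i = p := by
  obtain ⟨r', hr', head_mem⟩ := h.exists_cons
  rw [hr', Multiset.mem_cons] at hi
  exact hi.resolve_right fun hi => (Multiset.nodup_cons.1 hr).1 (hip ▸ head_mem i hi)

open Classical in
theorem countP_le_one (h : IsTree p r X) {l : List U} (hl : ∀ u ∈ l, u ∉ tails r) :
    (r.countP fun i => i.head ∈ l) ≤ 1 := by
  obtain ⟨r', hr, hr'⟩ := h.exists_cons
  have : (r'.countP fun i => i.head ∈ l) = 0 :=
    Multiset.countP_eq_zero.2 fun i hi hil => hl _ hil (hr' i hi)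
  rw [hr, Multiset.countP_cons, this]
  split_ifs <;> simp

open Classical in
theorem countP_eq_zero (h : IsTree p r X) {l : List U} (hl : ∀ u ∈ l, u ∉ p.head ::ₘ tails r) :
    (r.countP fun i => i.head ∈ l) = 0 :=
  Multiset.countP_eq_zero.2 fun _ hi hil => hl _ hil (h.head_mem hi)

open Classical in
theorem countP_cons_sum {i : Item S U} {l : List U} {o : S.Op}
    (s : S.Child o → Multiset (Item S U)) (hi : i.head ∉ l) :
    ((i ::ₘ ∑ k, s k).countP fun i => i.head ∈ l) = ∑ k, (s k).countP fun i => i.head ∈ l := by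
  rw [Multiset.countP_cons_of_neg (p := fun i : Item S U => i.head ∈ l) _ hi]
  exact map_sum (Multiset.countPAddMonoidHom _) _ _

open Classical in
theorem deterministic (h : IsTree p r X) (hr : (p.head ::ₘ tails r).Nodup) : Deterministic r := by
  induction h with
  | leaf A v => exact fun o w l h => by cases Multiset.mem_singleton.1 h
  | op o v q r X hq h ih =>
    rw [tails_cons, map_sum, Multiset.nodup_cons, Multiset.mem_add, not_or] at hr
    obtain ⟨⟨hv, hv'⟩, hr⟩ := hr
    obtain ⟨nodup_l, nodup_r, disj_l, disj_r⟩ := nodup_add_sum hr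
    have head_mem (k) : (q k).head ∈ lowerNodes o (head ∘ q) := (mem_lowerNodes hq).2 ⟨k, rfl⟩
    have head_notMem (j k) : (q j).head ∉ tails (r k) :=
      Multiset.disjoint_left.1 (disj_l k) (head_mem j)
    intro o' v' l' h'
    obtain h' | h' := Multiset.mem_cons.1 h'
    · cases h'
      refine ⟨nodup_l, ?_⟩
      rw [countP_cons_sum r (show v ∉ lowerNodes o (head ∘ q) from hv), Fintype.card_eq_sum_ones]
      exact Finset.sum_le_sum fun k _ => (h k).countP_le_one fun _ =>
        Multiset.disjoint_left.1 (disj_l k)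
    · obtain ⟨k, -, hk⟩ := Multiset.mem_sum.1 h'
      obtain ⟨nodup_l', card_le⟩ :=
        ih k (Multiset.nodup_cons.2 ⟨head_notMem k k, nodup_r k⟩) o' v' l' hk
      have mem_tails {u} (hu : u ∈ l') : u ∈ tails (r k) :=
        Multiset.mem_of_le (tail_le_tails hk) hu
      refine ⟨nodup_l', ?_⟩
      rw [countP_cons_sum, Fintype.sum_eq_single k]
      · exact card_le
      · refine fun j hjk => (h j).countP_eq_zero fun u hu huj => ?_
        obtain rfl | huj := Multiset.mem_cons.1 huj
        · exact head_notMem j k (mem_tails hu)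
        · exact Multiset.disjoint_left.1 (disj_r hjk) huj (mem_tails hu)
      · exact fun hv => hv' (Multiset.mem_sum.2 ⟨k, Finset.mem_univ k, mem_tails hv⟩)

end IsTree

open Classical in
theorem Deterministic.sum_singleton_eq {t : Multiset (Item S U)} (ht : Deterministic t) {o : S.Op}
    {v : U} {l : List U} {q : S.Child o → Item S U} (h : Item.op o v l ∈ t)
    (hq : ∀ k, (q k).head ∈ l) (hqt : ∑ k, {q k} ≤ t) :
    ∑ k, {q k} = t.filter fun i => i.head ∈ l := by
  refine Multiset.eq_of_le_of_card_le (Multiset.le_filter.2 ⟨hqt, fun i hi => ?_⟩) ?_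
  · obtain ⟨k, -, hk⟩ := Multiset.mem_sum.1 hi
    exact Multiset.mem_singleton.1 hk ▸ hq k
  · rw [← Multiset.countP_eq_card_filter]
    simpa using (ht o v l h).2

namespace IsTree

variable {p : Item S U} {r r' t : Multiset (Item S U)} {X X' : S.Db}

theorem sum_root_le {o : S.Op} {q : S.Child o → Item S U} {s : S.Child o → Multiset (Item S U)}
    {Y : S.Child o → S.Db} (h : ∀ k, IsTree (q k) (s k) (Y k)) : ∑ k, {q k} ≤ ∑ k, s k :=
  Finset.sum_le_sum fun k _ => Multiset.singleton_le.2 (h k).root_mem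

theorem unique (h : IsTree p r X) (h' : IsTree p r' X') (hr : r ≤ t) (hr' : r' ≤ t)
    (ht : Deterministic t) : r = r' ∧ Le X X' := by
  induction h generalizing r' X' with
  | leaf A v =>
    obtain ⟨rfl, rfl⟩ := h'.eq_of_leaf
    exact ⟨rfl, fun _ _ h => h⟩
  | op o v q r X hq h ih =>
    obtain ⟨q', s, Y, hq', lowerNodes_eq, hs, rfl, rfl⟩ := h'.exists_of_op
    have mem_t := Multiset.mem_of_le hr (Multiset.mem_cons_self _ _)
    have sum_le : ∑ k, r k ≤ t := (Multiset.le_cons_self _ _).trans hr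
    have sum_le' : ∑ k, s k ≤ t := (Multiset.le_cons_self _ _).trans hr'
    have sum_eq : ∑ k, {q k} = ∑ k, ({q' k} : Multiset (Item S U)) := by
      rw [ht.sum_singleton_eq mem_t (fun k => (mem_lowerNodes hq).2 ⟨k, rfl⟩)
          ((sum_root_le h).trans sum_le),
        ht.sum_singleton_eq mem_t (fun k => lowerNodes_eq ▸ (mem_lowerNodes hq').2 ⟨k, rfl⟩)
          ((sum_root_le hs).trans sum_le')]
    obtain ⟨σ, hσ⟩ := exists_equiv_of_finsum_singleton_eq (f := q) (g := q')
      (by rwa [finsum_eq_sum_of_fintype, finsum_eq_sum_of_fintype])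
    have child_eq (k) : r k = s (σ k) ∧ Le (X k) (Y (σ k)) :=
      ih k (hσ k ▸ hs (σ k))
        ((Finset.single_le_sum_of_canonicallyOrdered (Finset.mem_univ k)).trans sum_le)
        ((Finset.single_le_sum_of_canonicallyOrdered (Finset.mem_univ (σ k))).trans sum_le')
    have comm_or_eq_one : S.IsComm o ∨ σ = 1 := by
      refine or_iff_not_imp_left.2 fun ho => Equiv.ext fun k => ?_
      have head_eq := lowerNodes_injOn hq hq' lowerNodes_eq
      have head_inj := injective_of_nodup ho (ht o v _ mem_t).1
      refine head_inj ?_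
      rw [Function.comp_apply, Equiv.Perm.one_apply]
      exact (congrFun head_eq (σ k)).trans (congrArg head (hσ k))
    refine ⟨?_, fun Δ T hX => le_node_comp comm_or_eq_one Δ T ?_⟩
    · rw [← Equiv.sum_comp σ s, Finset.sum_congr rfl fun k _ => (child_eq k).1]
    · exact le_node (fun k => (child_eq k).2) Δ T hX

end IsTree

/-- Trees with root `u` can be grafted into `Δ`: together with the items `c` they form trees with
root `v`. -/
def IsGraft (Δ : S.DbCtx) (u v : U) (c : Multiset (Item S U)) : Prop :=
  ∀ q s X, IsTree q s X → q.head = u → ∃ p, p.head = v ∧ IsTree p (s + c) (Δ.plug X)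

theorem isGraft_hole (u : U) : IsGraft (S := S) .hole u u 0 := fun q s _ h hq =>
  ⟨q, hq, (add_zero s).symm ▸ h⟩

theorem IsGraft.nodeCtx {Δ : S.DbCtx} {u : U} {c : Multiset (Item S U)} {o : S.Op}
    {q : S.Child o → Item S U} {r : S.Child o → Multiset (Item S U)} {X : S.Child o → S.Db}
    {k : S.Child o} (hΔ : IsGraft Δ u (q k).head c) (v : U) (hq : Compat o (head ∘ q))
    (h : ∀ l, IsTree (q l) (r l) (X l)) :
    IsGraft (nodeCtx o X k Δ) u v
      (.op o v (lowerNodes o (head ∘ q)) ::ₘ (c + ∑ l ∈ Finset.univ.erase k, r l)) := by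
  intro q' s Y hY hq'
  obtain ⟨p, hp, h'⟩ := hΔ q' s Y hY hq'
  have head_comp_update : head ∘ Function.update q k p = head ∘ q := by
    rw [Function.comp_update, hp, ← Function.comp_apply (f := head), Function.update_eq_self]
  have h_update (l) : IsTree (Function.update q k p l) (Function.update r k (s + c) l)
      (Function.update X k (Δ.plug Y) l) := by
    obtain rfl | hl := eq_or_ne l k
    · simpa only [Function.update_self] using h'
    · simpa only [Function.update_of_ne hl] using h l
  have h_op := IsTree.op o v _ _ _ (head_comp_update ▸ hq) h_update
  rw [head_comp_update, Finset.sum_update_of_mem (Finset.mem_univ k),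
    Finset.sdiff_singleton_eq_erase, add_assoc, ← Multiset.add_cons, ← plug_nodeCtx] at h_op
  exact ⟨_, rfl, h_op⟩

namespace IsTree

variable {p q : Item S U} {r s c : Multiset (Item S U)} {X Z : S.Db}

theorem exists_plug (h : IsTree p r X) (hq : q ∈ r) :
    ∃ (Δ : S.DbCtx) (s c : Multiset (Item S U)) (Z : S.Db), IsTree q s Z ∧ r = s + c ∧
      X = Δ.plug Z ∧ IsGraft Δ q.head p.head c := by
  induction h with
  | leaf A v =>
    obtain rfl := Multiset.mem_singleton.1 hq
    exact ⟨.hole, _, 0, _, .leaf A v, (add_zero _).symm, rfl, isGraft_hole v⟩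
  | op o v p r X hp h ih =>
    obtain rfl | hq := Multiset.mem_cons.1 hq
    · exact ⟨.hole, _, 0, _, .op o v p r X hp h, (add_zero _).symm, rfl, isGraft_hole v⟩
    obtain ⟨k, -, hk⟩ := Multiset.mem_sum.1 hq
    obtain ⟨Δ, s, c, Z, hZ, hr, hX, hΔ⟩ := ih k hk
    refine ⟨nodeCtx o X k Δ, s, _, Z, hZ, ?_, ?_, hΔ.nodeCtx v hp h⟩
    · rw [← Finset.add_sum_erase _ _ (Finset.mem_univ k), hr, Multiset.add_cons, add_assoc]
    · rw [plug_nodeCtx, ← hX, Function.update_eq_self]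

theorem exists_replace (h : IsTree p (s + c) X) (hp : (p.head ::ₘ tails (s + c)).Nodup)
    (hs : IsTree q s Z) :
    ∃ Δ : S.DbCtx, (∀ T, Der X T → Der (Δ.plug Z) T) ∧ IsGraft Δ q.head p.head c := by
  obtain ⟨Δ, s', c', Z₁, h₁, hr, rfl, graft⟩ :=
    h.exists_plug (Multiset.mem_add.2 (.inl hs.root_mem))
  obtain ⟨rfl, le⟩ := h₁.unique hs (t := s + c) (hr ▸ Multiset.le_add_right _ _)
    (Multiset.le_add_right _ _) (h.deterministic hp)
  obtain rfl := add_left_cancel hr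
  exact ⟨Δ, le Δ, graft⟩

theorem exists_perm_of_leaf_mem {o : S.Op} {q : S.Child o → Item S U}
    {s : S.Child o → Multiset (Item S U)} {Y : S.Child o → S.Db} (hq : Compat o (head ∘ q))
    (h : ∀ k, IsTree (q k) (s k) (Y k))
    (hs : ((lowerNodes o (head ∘ q) : Multiset U) + ∑ k, tails (s k)).Nodup) (k : S.Child o)
    {B : S.Child o → S.Fm} (hB : ∀ l ≠ k, .leaf (B l) (q l).head ∈ ∑ j, s j) :
    ∃ σ : Equiv.Perm (S.Child o), (S.IsComm o ∨ σ = 1) ∧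
      ∀ l ≠ k, q (σ l) = .leaf (B l) (q l).head := by
  obtain ⟨nodup, -, disj, -⟩ := nodup_add_sum hs
  have exists_eq (l) (hl : l ≠ k) : ∃ j, q j = .leaf (B l) (q l).head := by
    obtain ⟨j, -, hj⟩ := Multiset.mem_sum.1 (hB l hl)
    obtain ⟨s', hs', head_mem⟩ := (h j).exists_cons
    rw [hs', Multiset.mem_cons] at hj
    refine ⟨j, (hj.resolve_right fun hj => ?_).symm⟩
    exact Multiset.disjoint_left.1 (disj j) ((mem_lowerNodes hq).2 ⟨l, rfl⟩)
      (head_mem (.leaf (B l) _) hj)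
  by_cases ho : S.IsComm o
  · by_cases hk : ∃ l, l ≠ k
    · obtain ⟨l, hl⟩ := hk
      obtain ⟨j, hj⟩ := exists_eq l hl
      refine ⟨Equiv.swap l j, .inl ho, fun l' hl' => ?_⟩
      obtain rfl := Child.eq_of_ne_of_ne hl' hl
      rwa [Equiv.swap_apply_left]
    · exact ⟨1, .inr rfl, fun l hl => (hk ⟨l, hl⟩).elim⟩
  · refine ⟨1, .inr rfl, fun l hl => ?_⟩
    obtain ⟨j, hj⟩ := exists_eq l hl
    obtain rfl : j = l := injective_of_nodup ho nodup (show (q j).head = (q l).head by rw [hj]; rfl)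
    exact hj

theorem exists_residual {o : S.Op} {v : U} {y : S.Child o → U} (hy : Compat o y) {k : S.Child o}
    {B : S.Child o → S.Fm} {A : S.Fm}
    (h : IsTree (.op o v (lowerNodes o y)) (.op o v (lowerNodes o y) ::ₘ
      (r + ∑ l ∈ {k}ᶜ, {.leaf (B l) (y l)})) X)
    (hr : ((lowerNodes o y : Multiset U) + tails r).Nodup) (hX : Der X A) :
    ∃ p Z, p.head = y k ∧ IsTree p r Z ∧ Der Z (residual o k B A) := by
  obtain ⟨q, s, Y, hq, low_eq, hs, cons_eq, rfl⟩ := h.exists_of_op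
  obtain rfl := lowerNodes_injOn hy hq low_eq
  have sum_eq := (Multiset.cons_inj_right _).1 cons_eq
  have tails_eq : ∑ j, tails (s j) = tails r := by
    rw [← map_sum, ← sum_eq, map_add, map_sum]
    simp [tails_singleton, tail]
  obtain ⟨σ, hσ, leaf_eq⟩ := exists_perm_of_leaf_mem hq hs (tails_eq ▸ hr) k (B := B)
    fun l hl => sum_eq ▸ Multiset.mem_add.2
      (.inr (Multiset.mem_sum.2 ⟨l, by simpa using hl, Multiset.mem_singleton_self _⟩))
  have eq_leaf (l) (hl : l ≠ k) :=
    eq_of_leaf (leaf_eq l hl ▸ hs (σ l))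
  have r_eq : r = s (σ k) := by
    rw [← Equiv.sum_comp σ s, Fintype.sum_eq_add_sum_compl k,
      Finset.sum_congr rfl fun l hl => (eq_leaf l (by simpa using hl)).1] at sum_eq
    exact add_right_cancel sum_eq
  have le : Le (node o Y) (node o (Y ∘ σ)) := by
    have hσ' : S.IsComm o ∨ σ⁻¹ = 1 := hσ.imp_right inv_eq_one.2
    simpa [Function.comp_assoc] using le_node_comp (X := Y ∘ σ) hσ'
  refine ⟨q (σ k), Y (σ k), ?_, r_eq ▸ hs (σ k),
    Der.residualR (X := Y ∘ σ) k (le .hole A hX) fun l hl => (eq_leaf l hl).2⟩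
  obtain ho | rfl := hσ
  exacts [hq ho (σ k) k, rfl]

end IsTree

/-- The multisets of items together with their inner nodes, such that the items form a tree with
root `v` and with a database in `P` provided that the nodes are distinct. -/
def treeSet (v : U) (P : S.Db → Prop) : Set (Multiset (Item S U) × Multiset U) :=
  {r | r.2 = tails r.1 ∧ ((v ::ₘ r.2).Nodup → ∃ p X, p.head = v ∧ IsTree p r.1 X ∧ P X)}

variable (S U) in
/-- The phase model in which an element of the pole of `(v, T)` is a tree with root `v` whose
database has the type `T`. -/
def canonicalModel :
    PhaseModel Pr U (U × S.Fm) (Multiset (Item S U) × Multiset U) where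
  weight u := (0, {u})
  val p a := {r | (∃ (h : Ranked.rk p = 1) (v : U), a = [v] ∧ r = ({.leaf (.prim ⟨p, h⟩) v}, 0)) ∨
    ∃ (o : S.Op) (v : U) (l : List U), p = symbol o ∧ a = v :: l ∧ r = ({.op o v l}, 0)}
  pole g := treeSet g.1 (Der · g.2)

theorem val_prim (p : {p : Pr // Ranked.rk p = 1}) (v : U) :
    (canonicalModel S U).val p.1 [v] = {({.leaf (.prim p) v}, 0)} := by
  refine Set.eq_singleton_iff_unique_mem.2 ⟨.inl ⟨p.2, v, rfl, rfl⟩, ?_⟩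
  rintro _ (⟨_, w, hw, rfl⟩ | ⟨o, -, -, ho, -⟩)
  · rw [List.singleton_inj.1 hw]
  · exact (rk_symbol_ne_one o (ho ▸ p.2)).elim

theorem val_symbol (o : S.Op) (v : U) (l : List U) :
    (canonicalModel S U).val (symbol o) (v :: l) = {({.op o v l}, 0)} := by
  refine Set.eq_singleton_iff_unique_mem.2 ⟨.inr ⟨o, v, l, rfl, rfl, rfl⟩, ?_⟩
  rintro _ (⟨h, -⟩ | ⟨o', _, _, ho, ha, rfl⟩)
  · exact (rk_symbol_ne_one o h).elim
  · obtain rfl := symbol_injective ho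
    cases ha
    rfl

theorem closure_treeSet_subset (v : U) (T : S.Fm) :
    (canonicalModel S U).closure (treeSet v (Der · T)) ⊆ treeSet v (Der · T) := fun r hr => by
  have := hr (v, T) 0 fun t ht => (add_zero t).symm ▸ ht
  rwa [add_zero] at this

theorem treeSet_mono (v : U) {P Q : S.Db → Prop} (h : ∀ X, P X → Q X) :
    treeSet v P ⊆ treeSet v Q := fun _ hr =>
  ⟨hr.1, fun hv => (hr.2 hv).imp fun _ ⟨X, hp, hX, hPX⟩ => ⟨X, hp, hX, h X hPX⟩⟩

theorem leaf_mem_treeSet (A : S.Fm) (v : U) : ({.leaf A v}, 0) ∈ treeSet v (· = .form A) :=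
  ⟨(tails_singleton (.leaf A v)).symm, fun _ => ⟨_, _, rfl, .leaf A v, rfl⟩⟩

theorem op_cons_sum_mem_treeSet {o : S.Op} {v : U} {y : S.Child o → U} (hy : Compat o y)
    {P : S.Child o → S.Db → Prop} {ρ : S.Child o → Multiset (Item S U) × Multiset U}
    (hρ : ∀ k, ρ k ∈ treeSet (y k) (P k)) :
    (.op o v (lowerNodes o y) ::ₘ ∑ k, (ρ k).1, ∑ k, (ρ k).2 + (lowerNodes o y : Multiset U)) ∈
      treeSet v fun X => ∃ Y, X = node o Y ∧ ∀ k, P k (Y k) := by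
  refine ⟨?_, fun h => ?_⟩
  · simp only [(hρ _).1, tails_cons, tail, map_sum, add_comm]
  · rw [Multiset.nodup_cons, add_comm] at h
    obtain ⟨-, nodup, disj, -⟩ := nodup_add_sum h.2
    have child (k) := (hρ k).2 (Multiset.nodup_cons.2
      ⟨Multiset.disjoint_left.1 (disj k) ((mem_lowerNodes hy).2 ⟨k, rfl⟩), nodup k⟩)
    choose q Y hq hY hPY using child
    obtain rfl : head ∘ q = y := funext hq
    refine ⟨.op o v (lowerNodes o (head ∘ q)), _, rfl, ?_, Y, rfl, hPY⟩
    exact IsTree.op o v q _ Y hy hY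

theorem patternVal_subset_closure_treeSet {o : S.Op} {φ : S.Child o → U → Set _}
    {P : S.Child o → S.Db → Prop} (hφ : ∀ k u, φ k u ⊆ treeSet u (P k)) (v : U) :
    patternVal (canonicalModel S U).weight o ((Formula.prim (symbol o)).sem (canonicalModel S U))
        φ [v] ⊆
      (canonicalModel S U).closure (treeSet v fun X => ∃ Y, X = node o Y ∧ ∀ k, P k (Y k)) := by
  rintro _ ⟨w, y, ρ₀, ρ, hy, hw, hρ₀, hρ, rfl⟩ g c hc
  obtain rfl := List.singleton_inj.1 hw
  rw [Formula.sem_prim, val_symbol] at hρ₀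
  rw [add_assoc, add_assoc]
  refine hρ₀ g _ fun t ht => ?_
  obtain rfl := Set.mem_singleton_iff.1 ht
  have mem_pole := hc _ (op_cons_sum_mem_treeSet hy fun k => hφ k _ (hρ k))
  rw [← singleton_add_sum_add, add_assoc, add_assoc] at mem_pole
  exact mem_pole

theorem treeSet_subset_closure_leaf (A : S.Fm) (v : U) :
    treeSet v (Le (.form A)) ⊆ (canonicalModel S U).closure {({.leaf A v}, 0)} := by
  rintro t ⟨ht, exists_tree⟩ ⟨w, T⟩ c mem_pole
  obtain ⟨hc, exists_tree'⟩ := mem_pole _ rfl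
  rw [Prod.fst_add, Prod.snd_add, zero_add, tails_leaf_add] at hc
  refine ⟨by simp [ht, hc], fun hw => ?_⟩
  rw [Prod.snd_add, ← Multiset.add_cons, add_comm] at hw
  obtain ⟨nodup_c, nodup_t, disj⟩ := Multiset.nodup_add.1 hw
  obtain ⟨p, X, rfl, hX, hT⟩ := exists_tree' (by rwa [Prod.snd_add, zero_add])
  rw [hc] at disj nodup_c
  have hv : v ∈ p.head ::ₘ tails c.1 :=
    tails_leaf_add A v c.1 ▸ hX.head_mem (Multiset.mem_add.2 (.inl (Multiset.mem_singleton_self _)))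
  obtain ⟨q, Z, rfl, hZ, le⟩ := exists_tree
    (Multiset.nodup_cons.2 ⟨Multiset.disjoint_left.1 disj hv, nodup_t⟩)
  obtain ⟨Δ, hΔ, graft⟩ := hX.exists_replace (tails_leaf_add A q.head c.1 ▸ nodup_c)
    (.leaf A q.head)
  obtain ⟨p', hp', h'⟩ := graft q t.1 Z hZ rfl
  exact ⟨p', _, hp', h', le Δ T (hΔ T hT)⟩

theorem exists_compat_nodup [Infinite U] {o : S.Op} (k : S.Child o) {u : U} {s : Multiset U}
    (h : (u ::ₘ s).Nodup) :
    ∃ y : S.Child o → U, y k = u ∧ Compat o y ∧ ((lowerNodes o y : Multiset U) + s).Nodup := by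
  obtain ⟨w, hw⟩ := exists_fresh (u ::ₘ s)
  have nodup_pair : ((w ::ₘ u ::ₘ s)).Nodup := Multiset.nodup_cons.2 ⟨hw, h⟩
  obtain i | j := o
  · by_cases hi : i ∈ S.C
    · exact ⟨fun _ => u, rfl, fun _ _ _ => rfl, by simpa [lowerNodes, hi] using h⟩
    · revert k
      refine Fin.forall_fin_two.2 ⟨⟨![u, w], rfl, fun hi' => (hi hi').elim, ?_⟩,
        ⟨![w, u], rfl, fun hi' => (hi hi').elim, ?_⟩⟩
      · rw [Multiset.cons_swap] at nodup_pair
        simpa [lowerNodes, hi, ← Multiset.cons_coe] using nodup_pair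
      · simpa [lowerNodes, hi, ← Multiset.cons_coe] using nodup_pair
  · exact ⟨fun _ => u, rfl, fun _ _ _ => rfl, h⟩

theorem op_cons_sum_mem_patternVal {o : S.Op} (v : U) {y : S.Child o → U} (hy : Compat o y)
    {φ : S.Child o → U → Set (Multiset (Item S U) × Multiset U)}
    {ρ : S.Child o → Multiset (Item S U) × Multiset U} (hρ : ∀ k, ρ k ∈ φ k (y k)) :
    (.op o v (lowerNodes o y) ::ₘ ∑ k, (ρ k).1, ∑ k, (ρ k).2 + (lowerNodes o y : Multiset U)) ∈
      patternVal (canonicalModel S U).weight o ((Formula.prim (symbol o)).sem (canonicalModel S U))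
        φ [v] := by
  refine ⟨v, y, _, ρ, hy, rfl, ?_, hρ, (singleton_add_sum_add _ ρ _).symm⟩
  rw [Formula.sem_prim, val_symbol]
  exact PhaseModel.subset_closure _ _ rfl

theorem leaf_mem_sem_mu_prod [Infinite U] {o : S.Op} {A : S.Child o → S.Fm}
    (hA : ∀ k (u : U), ({.leaf (A k) u}, 0) ∈ (S.mu (A k)).sem (canonicalModel S U) [u]) (v : U) :
    ({.leaf (prod o A) v}, 0) ∈ (S.mu (prod o A)).sem (canonicalModel S U) [v] := by
  rw [sem_mu_prod]
  rintro ⟨w, T⟩ c mem_pole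
  have mem_treeSet {y : S.Child o → U} (hy : Compat o y) :
      ((.op o v (lowerNodes o y) ::ₘ ∑ k, {.leaf (A k) (y k)}) + c.1,
        (lowerNodes o y : Multiset U) + c.2) ∈ treeSet w (Der · T) := by
    have := mem_pole _ (op_cons_sum_mem_patternVal v hy fun k => hA k (y k))
    rwa [Finset.sum_const_zero, zero_add] at this
  have hc : c.2 = tails c.1 := by
    have := (mem_treeSet (y := fun _ => v) fun _ _ _ => rfl).1
    simpa [tails_cons, tails_singleton, tail] using this
  refine ⟨by rw [Prod.snd_add, Prod.fst_add, tails_leaf_add, zero_add, hc], fun hw => ?_⟩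
  rw [Prod.snd_add, zero_add] at hw
  obtain ⟨u, hu⟩ := exists_fresh (w ::ₘ c.2)
  obtain ⟨y, -, hy, nodup⟩ := exists_compat_nodup (Classical.arbitrary (S.Child o))
    (Multiset.nodup_cons.2 ⟨hu, hw⟩)
  obtain ⟨tails_eq, exists_tree⟩ := mem_treeSet hy
  rw [Multiset.add_cons] at nodup
  obtain ⟨p, X, rfl, hX, hT⟩ := exists_tree nodup
  obtain ⟨Δ, hΔ, graft⟩ := hX.exists_replace (tails_eq ▸ nodup)
    (.op o v (fun k => .leaf (A k) (y k)) _ _ hy fun k => .leaf (A k) (y k))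
  obtain ⟨p', hp', h'⟩ := graft _ _ _ (.leaf (prod o A) v) rfl
  exact ⟨p', _, hp', h', Der.prodL (hΔ T hT)⟩

theorem sem_mu_prod_subset_treeSet {o : S.Op} {A : S.Child o → S.Fm}
    (hA : ∀ k (u : U), (S.mu (A k)).sem (canonicalModel S U) [u] ⊆ treeSet u (Der · (A k)))
    (v : U) : (S.mu (prod o A)).sem (canonicalModel S U) [v] ⊆ treeSet v (Der · (prod o A)) := by
  rw [sem_mu_prod]
  refine (PhaseModel.closure_mono _ (patternVal_subset_closure_treeSet hA v)).trans <|
    (PhaseModel.closure_closure_subset _ _).trans <|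
    (PhaseModel.closure_mono _ (treeSet_mono v ?_)).trans (closure_treeSet_subset v _)
  rintro _ ⟨Y, rfl, hY⟩
  exact Der.prodR hY

theorem leaf_mem_sem_mu_residual {o : S.Op} (k : S.Child o) {B : S.Child o → S.Fm} {A : S.Fm}
    (hB : ∀ l (u : U), (S.mu (B l)).sem (canonicalModel S U) [u] ⊆ treeSet u (Der · (B l)))
    (hA : ∀ u : U, ({.leaf A u}, 0) ∈ (S.mu A).sem (canonicalModel S U) [u]) (v : U) :
    ({.leaf (residual o k B A) v}, 0) ∈
      (S.mu (residual o k B A)).sem (canonicalModel S U) [v] := by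
  classical
  refine (mem_sem_mu_residual _).2 fun b r hr => ?_
  obtain ⟨w, -, -, -, -, rfl, -⟩ := id hr
  have hr' := patternVal_subset_closure_treeSet
    (P := fun l X => if l = k then X = .form (residual o k B A) else Der X (B l))
    (fun l u => by
      split_ifs with hl
      · rintro _ ⟨hu, rfl⟩
        obtain rfl := List.singleton_inj.1 hu
        exact leaf_mem_treeSet _ _
      · exact hB l u) w hr
  refine Formula.closure_sem_subset _ _ _ <|
    PhaseModel.closure_mono _ (Set.singleton_subset_iff.2 (hA w)) <|
    PhaseModel.closure_closure_subset _ _ <|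
    PhaseModel.closure_mono _ ((treeSet_mono w ?_).trans (treeSet_subset_closure_leaf A w)) hr'
  rintro _ ⟨Y, rfl, hY⟩ Δ T hT
  exact Der.residualL k hT (by simpa using hY k) fun l hl => by simpa [hl] using hY l

theorem op_cons_add_sum_leaf_mem_treeSet {o : S.Op} {k : S.Child o} {B : S.Child o → S.Fm}
    {A : S.Fm}
    (hB : ∀ l (u : U), ({.leaf (B l) u}, 0) ∈ (S.mu (B l)).sem (canonicalModel S U) [u])
    (hA : ∀ u : U, (S.mu A).sem (canonicalModel S U) [u] ⊆ treeSet u (Der · A))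
    {r : Multiset (Item S U) × Multiset U} {y : S.Child o → U} (hy : Compat o y)
    (hr : r ∈ (S.mu (residual o k B A)).sem (canonicalModel S U) [y k]) (v : U) :
    (.op o v (lowerNodes o y) ::ₘ (r.1 + ∑ l ∈ {k}ᶜ, {.leaf (B l) (y l)}),
      r.2 + (lowerNodes o y : Multiset U)) ∈ treeSet v (Der · A) := by
  classical
  have h := hA v ((mem_sem_mu_residual _).1 hr _ (op_cons_sum_mem_patternVal v hy
    (ρ := fun l => if l = k then r else ({.leaf (B l) (y l)}, 0)) fun l => ?_))
  · have ne_of_mem {l} (hl : l ∈ ({k}ᶜ : Finset (S.Child o))) : l ≠ k := by simpa using hl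
    rw [Fintype.sum_eq_add_sum_compl k, Fintype.sum_eq_add_sum_compl k, if_pos rfl,
      Finset.sum_congr rfl fun l hl => congrArg Prod.fst (if_neg (ne_of_mem hl)),
      Finset.sum_congr rfl fun l hl => congrArg Prod.snd (if_neg (ne_of_mem hl)),
      Finset.sum_const_zero, add_zero] at h
    exact h
  · split_ifs with hl
    exacts [⟨by rw [hl], rfl⟩, hB l (y l)]

theorem sem_mu_residual_subset_treeSet [Infinite U] {o : S.Op} (k : S.Child o)
    {B : S.Child o → S.Fm} {A : S.Fm}
    (hB : ∀ l (u : U), ({.leaf (B l) u}, 0) ∈ (S.mu (B l)).sem (canonicalModel S U) [u])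
    (hA : ∀ u : U, (S.mu A).sem (canonicalModel S U) [u] ⊆ treeSet u (Der · A)) (u : U) :
    (S.mu (residual o k B A)).sem (canonicalModel S U) [u] ⊆
      treeSet u (Der · (residual o k B A)) := by
  intro r hr
  have hr₂ : r.2 = tails r.1 := by
    have := (op_cons_add_sum_leaf_mem_treeSet (y := fun _ => u) hB hA (fun _ _ _ => rfl) hr u).1
    simpa [tails_cons, tails_singleton, tail, add_comm r.2] using this
  refine ⟨hr₂, fun nodup_u => ?_⟩
  obtain ⟨y, rfl, hy, nodup_y⟩ := exists_compat_nodup k nodup_u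
  obtain ⟨v, hv⟩ := exists_fresh ((lowerNodes o y : Multiset U) + r.2)
  have nodup_v := Multiset.nodup_cons.2 ⟨hv, nodup_y⟩
  obtain ⟨tails_eq, exists_tree⟩ := op_cons_add_sum_leaf_mem_treeSet hB hA hy hr v
  rw [add_comm] at nodup_v
  obtain ⟨p, X, rfl, hX, hXA⟩ := exists_tree nodup_v
  rw [← hX.eq_root (tails_eq ▸ nodup_v) (Multiset.mem_cons_self _ _) rfl] at hX
  exact hX.exists_residual hy (hr₂ ▸ nodup_y) hXA

theorem leaf_mem_sem_mu_and_sem_mu_subset_treeSet [Infinite U] (A : S.Fm) :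
    (∀ v : U, ({.leaf A v}, 0) ∈ (S.mu A).sem (canonicalModel S U) [v]) ∧
      ∀ v : U, (S.mu A).sem (canonicalModel S U) [v] ⊆ treeSet v (Der · A) := by
  induction A using fm_induction with
  | prim p =>
    refine ⟨fun v => ?_, fun v => ?_⟩
    · rw [show S.mu (.prim p) = .prim p.1 from rfl, Formula.sem_prim, val_prim]
      exact PhaseModel.subset_closure _ _ rfl
    · rw [show S.mu (.prim p) = .prim p.1 from rfl, Formula.sem_prim, val_prim]
      refine (PhaseModel.closure_mono _ ?_).trans (closure_treeSet_subset v _)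
      refine Set.singleton_subset_iff.2 (treeSet_mono v ?_ (leaf_mem_treeSet _ v))
      rintro _ rfl
      exact .ax _
  | prod o A hA =>
    exact ⟨leaf_mem_sem_mu_prod fun k => (hA k).1, sem_mu_prod_subset_treeSet fun k => (hA k).2⟩
  | residual o k B A hB hA =>
    exact ⟨leaf_mem_sem_mu_residual k (fun l => (hB l).2) hA.1,
      sem_mu_residual_subset_treeSet k (fun l => (hB l).1) hA.2⟩

/-- The labeled and placed hyperedge that an item stands for. -/
noncomputable def Item.toEdge : Item S U → Formula Pr × List U
  | leaf A v => (S.mu A, [v])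
  | op o v l => (.prim (symbol o), v :: l)

/-- The configuration formed by the items `r` and the nodes below them. -/
noncomputable def toConfig (r : Multiset (Item S U)) : Config (Formula Pr) U :=
  (r.map toEdge, tails r)

theorem toConfig_singleton_leaf (A : S.Fm) (v : U) :
    toConfig {leaf A v} = ({(S.mu A, [v])}, 0) := by
  rw [toConfig, tails_singleton, Multiset.map_singleton]
  rfl

theorem toConfig_op_cons_sum (o : S.Op) (v : U) (l : List U)
    (r : S.Child o → Multiset (Item S U)) :
    toConfig (.op o v l ::ₘ ∑ k, r k) = ({(.prim (symbol o), v :: l)}, 0) +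
      ∑ k, toConfig (r k) + (l.map (nodeConfig (Formula Pr))).sum := by
  have map_sum_toEdge : (∑ k, r k).map toEdge = ∑ k, (r k).map toEdge :=
    map_sum (Multiset.mapAddMonoidHom toEdge) r _
  rw [toConfig, Multiset.map_cons, map_sum_toEdge, tails_cons, map_sum, add_comm (_ : Multiset U)]
  exact (singleton_add_sum_add _ (fun k => toConfig (r k)) l).symm

theorem IsTree.toConfig_mem_images {p : Item S U} {r : Multiset (Item S U)} {X : S.Db}
    (h : IsTree p r X) : toConfig r ∈ (S.htree X).images [p.head] := by
  induction h with
  | leaf A v => exact mem_eval_handle.2 ⟨(rk_mu A).symm, toConfig_singleton_leaf A v⟩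
  | op o v q r X hq _ ih =>
    rw [images_htree_node]
    exact ⟨v, head ∘ q, _, _, hq, rfl, rfl, ih, toConfig_op_cons_sum ..⟩

theorem exists_tree_of_mem_images {X : S.Db} {a : List U} {c : Config (Formula Pr) U}
    (h : c ∈ (S.htree X).images a) : ∃ p r, IsTree p r X ∧ a = [p.head] ∧ c = toConfig r := by
  induction X using db_induction generalizing a c with
  | form A =>
    obtain ⟨ha, hc⟩ := mem_eval_handle.1 h
    obtain ⟨v, rfl⟩ := List.length_eq_one_iff.1 (ha.trans (rk_mu A))
    exact ⟨_, _, .leaf A v, rfl, hc.trans (toConfig_singleton_leaf A v).symm⟩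
  | node o X ih =>
    rw [images_htree_node] at h
    obtain ⟨v, y, ρ₀, ρ, hy, rfl, rfl, hρ, rfl⟩ := h
    choose q r hr hq hρr using fun k => ih k (hρ k)
    obtain rfl : y = head ∘ q := funext fun k => List.singleton_inj.1 (hq k)
    exact ⟨_, _, .op o v q r X hy hr, rfl, funext hρr ▸ (toConfig_op_cons_sum ..).symm⟩

theorem isSimple_toEdge (i : Item S U) : i.toEdge.1.IsSimple := by
  cases i with
  | leaf A v => exact isSimple_mu A
  | op o v l => trivial

theorem mem_sem_toEdge [Infinite U] (i : Item S U) :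
    ({i}, 0) ∈ i.toEdge.1.sem (canonicalModel S U) i.toEdge.2 := by
  cases i with
  | leaf A v => exact (leaf_mem_sem_mu_and_sem_mu_subset_treeSet A).1 v
  | op o v l =>
    rw [toEdge, Formula.sem_prim, val_symbol]
    exact PhaseModel.subset_closure _ _ rfl

theorem exists_tree_of_derivable [Infinite U] {G : HL.Hypergraph (Formula Pr)} {T : S.Fm}
    (hG : HL.Derivable G (S.mu T)) {f : G.V → U} (hf : Function.Injective f)
    {r : Multiset (Item S U)} (hr : r.map toEdge = (G.image f).1) :
    ∃ p X, G.ext.map f = [p.head] ∧ (p.head ::ₘ tails r).Nodup ∧ G.image f = toConfig r ∧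
      IsTree p r X ∧ Der X T := by
  obtain ⟨χ, rfl, hχ⟩ := exists_finsum_singleton_of_map_eq hr
  obtain ⟨v, hv⟩ : ∃ v, G.ext.map f = [v] :=
    List.length_eq_one_iff.1 ((List.length_map _).trans (hG.length_ext.trans (rk_mu T)))
  have hedge (e) : (G.lab e).IsSimple ∧
      ({χ e}, 0) ∈ (G.lab e).sem (canonicalModel S U) ((G.att e).map f) := by
    have hlab : (χ e).toEdge.1 = G.lab e := congrArg Prod.fst (hχ e)
    have hatt : (χ e).toEdge.2 = (G.att e).map f := congrArg Prod.snd (hχ e)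
    rw [← hlab, ← hatt]
    exact ⟨isSimple_toEdge (χ e), mem_sem_toEdge (χ e)⟩
  have mem_sem : (∑ᶠ e, {χ e}, (G.image f).2) ∈ G.sem (canonicalModel S U) [v] := by
    refine ⟨f, fun e => ({χ e}, 0), hv, fun e => (hedge e).2, ?_⟩
    simp [finsum_prod_eq, canonicalModel, image]
  obtain ⟨inner_eq, exists_tree⟩ := (leaf_mem_sem_mu_and_sem_mu_subset_treeSet T).2 v
    (hG.sem_subset _ (fun e => (hedge e).1) (isSimple_mu T) _ mem_sem)
  have nodup : (v ::ₘ (G.image f).2).Nodup := by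
    have ext_nodup : G.ext.Nodup := .of_map f (hv ▸ List.nodup_singleton v)
    simpa [hv] using nodup_map_ext_add_image_snd ext_nodup hf
  obtain ⟨p, X, rfl, hX, hT⟩ := exists_tree nodup
  exact ⟨p, X, hv, inner_eq ▸ nodup, Prod.ext hr.symm inner_eq, hX, hT⟩

theorem exists_toEdge_eq {A : Formula Pr} (hA : A ∈ S.labels) {a : List U}
    (ha : Ranked.rk A = a.length) : ∃ i : Item S U, i.toEdge = (A, a) := by
  obtain ⟨A, rfl⟩ | ⟨p, hp, rfl⟩ := hA
  · obtain ⟨v, rfl⟩ := List.length_eq_one_iff.1 (ha.symm.trans (rk_mu A))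
    exact ⟨.leaf A v, rfl⟩
  · obtain ⟨o, rfl⟩ : ∃ o : S.Op, symbol o = p :=
      hp.elim (fun hp => ⟨.inl ⟨p, hp⟩, rfl⟩) fun hp => ⟨.inr ⟨p, hp⟩, rfl⟩
    obtain _ | ⟨v, l⟩ := a
    · cases ha.symm.trans (rk_symbol o () fun _ => ())
    · exact ⟨.op o v l, rfl⟩

theorem exists_iso_htree_of_derivable {G : HL.Hypergraph (Formula Pr)} {T : S.Fm}
    (hlab : ∀ e, G.lab e ∈ S.labels) (hG : HL.Derivable G (S.mu T)) :
    ∃ X, G.Iso (S.htree X) ∧ Der X T := by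
  let f : G.V → G.V ⊕ ℕ := Sum.inl
  have exists_item (e) : ∃ i : Item S (G.V ⊕ ℕ), i.toEdge = (G.lab e, (G.att e).map f) :=
    exists_toEdge_eq (hlab e) ((G.rk_lab e).trans (List.length_map f).symm)
  choose χ hχ using exists_item
  have hr : (∑ᶠ e, {χ e} : Multiset _).map toEdge = (G.image f).1 :=
    ((Multiset.mapAddMonoidHom toEdge).map_finsum (Set.toFinite _)).trans
      (finsum_congr fun e => congrArg singleton (hχ e))
  obtain ⟨p, X, hext, -, image_eq, hX, hT⟩ :=
    exists_tree_of_derivable (f := f) hG Sum.inl_injective hr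
  refine ⟨X, iso_of_image_mem_images (f := f) ?_ Sum.inl_injective ?_, hT⟩
  · exact .of_map f (hext ▸ List.nodup_singleton _)
  · rw [hext, image_eq]
    exact hX.toConfig_mem_images

theorem der_of_derivable {X : S.Db} {T : S.Fm} (h : HL.Derivable (S.htree X) (S.mu T)) :
    Der X T := by
  let f : (S.htree X).V → (S.htree X).V ⊕ ℕ := Sum.inl
  obtain ⟨p, r, hX, hp, hr⟩ := exists_tree_of_mem_images (mem_images.2 ⟨f, rfl, rfl⟩)
  obtain ⟨p', X', hp', nodup, -, hX', hT⟩ :=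
    exists_tree_of_derivable (f := f) h Sum.inl_injective (congrArg Prod.fst hr).symm
  have head_eq : p.head = p'.head := List.singleton_inj.1 (hp.symm.trans hp')
  obtain rfl := hX'.eq_root nodup hX.root_mem head_eq
  exact (hX'.unique hX le_rfl le_rfl (hX'.deterministic nodup)).2 .hole T hT

end Trees

theorem images_htree_form {U : Type*} (A : S.Fm) (u : U) :
    (S.htree (.form A)).images [u] = edgeConfig (S.mu A) [u] :=
  images_handle (rk_mu A).symm

theorem iso_htree_node {G : HL.Hypergraph (Formula Pr)} {V E : Type} [Finite E]
    {att : E → List V} {ext : List V} {o : S.Op} {X : S.Child o → S.Db} (s : Pattern o att ext)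
    (hG : G.ext.Nodup) {φ : E → List G.V → Set (Config (Formula Pr) G.V)}
    (hφ : G.images = eval (nodeConfig _) att ext φ)
    (h₀ : ∀ b : List G.V, b.length = Ranked.rk (symbol o) →
      φ (s.edge none) b ⊆ edgeConfig (.prim (symbol o)) b)
    (h : ∀ k u, φ (s.edge (some k)) [u] ⊆ (S.htree (X k)).images [u]) :
    G.Iso (S.htree (node o X)) := by
  refine iso_of_images_subset hG ?_
  rw [hφ, s.eval_eq, images_htree_node]
  exact patternVal_subset h₀ h _

theorem exists_edge_node {o : S.Op} {X X' : S.Child o → S.Db} {k : S.Child o} {A : S.Fm}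
    {M : HL.Hypergraph (Formula Pr)} (hX : ∀ l ≠ k, X l = X' l) (hM : M.ext.length = 1)
    (h : ∃ e : (S.htree (X k)).E, (S.htree (X k)).lab e = S.mu A ∧
      ((S.htree (X k)).replaceOne e M).Iso (S.htree (X' k))) :
    ∃ e : (S.htree (node o X)).E, (S.htree (node o X)).lab e = S.mu A ∧
      ((S.htree (node o X)).replaceOne e M).Iso (S.htree (node o X')) := by
  obtain ⟨e, he, hiso⟩ := h
  obtain ⟨G, s, m, hG, h₀, hm⟩ := exists_htree_node_eq o X
  have hMe : M.ext.length = ((S.htree (X k)).att e).length := by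
    rw [← (S.htree (X k)).rk_lab, he, hM, rk_mu A]
  have hlen (l) : (S.htree (X l)).ext.length = (G.att (m l)).length := by
    rw [length_ext_htree, ← hm, Pattern.length_att_edge]
  rw [hG]
  refine ⟨partEdge m _ k e, he, iso_htree_node s ?_ (images_replaceOne_partEdge hlen
    (fun l => nodup_ext_htree (X l)) hMe (nodup_of_length_eq_one hM)) (fun b _ => ?_) fun l u => ?_⟩
  · exact nodup_of_length_eq_one
      (length_ext_replace.trans (length_ext_replace.trans (congrArg List.length s.ext_eq)))
  · have none_notMem : ¬ ∃ l, m l = s.edge none := fun ⟨l, hl⟩ =>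
      Option.some_ne_none l (s.edge.injective ((hm l).trans hl))
    rw [Function.extend_apply' _ _ _ none_notMem, h₀]
  · rw [hm, m.injective.extend_apply]
    obtain rfl | hl := eq_or_ne l k
    · rw [Function.update_self, hiso.images_eq]
    · rw [Function.update_of_ne hl, hX l hl]

theorem exists_edge_plug {M : HL.Hypergraph (Formula Pr)} {Y : S.Db} (hM : M.Iso (S.htree Y))
    (A : S.Fm) (Δ : S.DbCtx) : ∃ e : (S.htree (Δ.plug (.form A))).E,
      (S.htree (Δ.plug (.form A))).lab e = S.mu A ∧
      ((S.htree (Δ.plug (.form A))).replaceOne e M).Iso (S.htree (Δ.plug Y)) := by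
  have : Nonempty S.Db := ⟨Y⟩
  have hlen : M.ext.length = 1 := by
    obtain ⟨σ, -, -, -, hext⟩ := hM
    rw [← length_ext_htree Y, hext, List.length_map]
  induction Δ using ctx_induction with
  | hole =>
    exact ⟨(), rfl, (handle_replaceOne_iso (hlen.trans (rk_mu A).symm)
      (nodup_of_length_eq_one hlen)).trans hM⟩
  | nodeCtx o X k Δ ih =>
    rw [plug_nodeCtx, plug_nodeCtx]
    refine exists_edge_node (k := k)
      (fun l hl => by rw [Function.update_of_ne hl, Function.update_of_ne hl]) hlen ?_
    rwa [Function.update_self, Function.update_self]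

theorem htree_node_iso {o : S.Op} {X Y : S.Child o → S.Db}
    (h : ∀ k, (S.htree (X k)).Iso (S.htree (Y k))) :
    (S.htree (node o X)).Iso (S.htree (node o Y)) := by
  refine iso_of_images_subset (nodup_ext_htree _) ?_
  rw [images_htree_node, images_htree_node]
  exact patternVal_subset (fun _ _ => le_rfl) (fun k u => (congrFun (h k).images_eq [u]).le) _

theorem htree_plug_iso {X Y : S.Db} (h : (S.htree X).Iso (S.htree Y)) (Δ : S.DbCtx) :
    (S.htree (Δ.plug X)).Iso (S.htree (Δ.plug Y)) := by
  have : Nonempty S.Db := ⟨Y⟩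
  induction Δ using ctx_induction with
  | hole => exact h
  | nodeCtx o X k Δ ih =>
    rw [plug_nodeCtx, plug_nodeCtx]
    refine htree_node_iso fun l => ?_
    obtain rfl | hl := eq_or_ne l k
    · rwa [Function.update_self, Function.update_self]
    · rw [Function.update_of_ne hl, Function.update_of_ne hl]
      exact .refl _

theorem htree_node_comp_iso {o : S.Op} (ho : S.IsComm o) (σ : Equiv.Perm (S.Child o))
    (X : S.Child o → S.Db) : (S.htree (node o (X ∘ σ))).Iso (S.htree (node o X)) := by
  refine iso_of_images_subset (nodup_ext_htree _) ?_
  rw [images_htree_node, images_htree_node]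
  rintro _ ⟨v, y, ρ₀, ρ, hy, ha, hρ₀, hρ, rfl⟩
  refine ⟨v, y, ρ₀, ρ ∘ σ.symm, hy, ha, hρ₀, fun k => ?_, ?_⟩
  · simpa [hy ho (σ.symm k) k] using hρ (σ.symm k)
  · rw [← Equiv.sum_comp σ.symm ρ]
    rfl

namespace Pattern

variable {o : S.Op} {V E : Type} {att : E → List V} {ext : List V} (s : Pattern o att ext)

/-- The hypergraphs to be put into a pattern of `o` in order to obtain `htree (node o X)`. -/
noncomputable def filling (X : S.Child o → S.Db) (e : E) : HL.Hypergraph (Formula Pr) :=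
  (s.edge.symm e).elim (.handle (.prim (symbol o))) fun k => S.htree (X k)

variable (X : S.Child o → S.Db)

theorem filling_none : s.filling X (s.edge none) = .handle (.prim (symbol o)) := by
  rw [filling, Equiv.symm_apply_apply]
  rfl

theorem filling_some (k : S.Child o) : s.filling X (s.edge (some k)) = S.htree (X k) := by
  rw [filling, Equiv.symm_apply_apply]
  rfl

theorem length_ext_filling (e : E) : (s.filling X e).ext.length = (att e).length := by
  obtain ⟨_ | k, rfl⟩ := s.edge.surjective e
  · rw [filling_none, s.att_none, ← rk_symbol]
    exact List.length_finRange
  · rw [filling_some, s.att_some, length_ext_htree, List.length_singleton]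

theorem nodup_ext_filling (e : E) : (s.filling X e).ext.Nodup := by
  obtain ⟨_ | k, rfl⟩ := s.edge.surjective e
  · exact filling_none s X ▸ List.nodup_finRange _
  · exact filling_some s X k ▸ nodup_ext_htree _

end Pattern

theorem derivable_plug_prod {Δ : S.DbCtx} {o : S.Op} {A : S.Child o → S.Fm} {B : Formula Pr}
    (h : HL.Derivable (S.htree (Δ.plug (node o fun k => .form (A k)))) B) :
    HL.Derivable (S.htree (Δ.plug (.form (prod o A)))) B := by
  obtain ⟨G, s, hG, h₀, hA⟩ := exists_mu_prod_eq o A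
  have hiso : G.Iso (S.htree (node o fun k => .form (A k))) := by
    refine iso_htree_node s s.nodup_ext rfl (fun _ _ => h₀ ▸ le_rfl) fun k u => ?_
    rw [images_htree_form, hA]
  obtain ⟨e, he, hiso'⟩ := exists_edge_plug hiso (prod o A) Δ
  exact .timesL _ e G _ (he.trans hG) (.iso hiso'.symm h)

theorem derivable_node_prod {o : S.Op} {X : S.Child o → S.Db} {A : S.Child o → S.Fm}
    (h : ∀ k, HL.Derivable (S.htree (X k)) (S.mu (A k))) :
    HL.Derivable (S.htree (node o X)) (S.mu (prod o A)) := by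
  obtain ⟨G, s, hG, h₀, hA⟩ := exists_mu_prod_eq o A
  have filling_derivable (e) : HL.Derivable (s.filling X e) (G.lab e) := by
    obtain ⟨_ | k, rfl⟩ := s.edge.surjective e
    · rw [s.filling_none, h₀]
      exact .ax _
    · rw [s.filling_some, hA]
      exact h k
  have hlen := s.length_ext_filling X
  have hnodup := s.nodup_ext_filling X
  have hiso : (G.replaceAll (s.filling X)).Iso (S.htree (node o X)) := by
    refine iso_htree_node s ?_ (images_replaceAll hlen hnodup) (fun b hb => ?_) fun k u => ?_
    · exact (nodup_ext_replace_iff hlen hnodup).2 s.nodup_ext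
    · rw [s.filling_none]
      exact (images_handle (a := Formula.prim (symbol o)) hb).le
    · exact s.filling_some X k ▸ le_rfl
  exact hG ▸ .iso hiso (.timesR G _ filling_derivable)

theorem derivable_plug_node {Δ : S.DbCtx} {o : S.Op} {X : S.Child o → S.Db} {k : S.Child o}
    {B : S.Child o → S.Fm} {A : S.Fm} {T : Formula Pr}
    (hk : X k = .form (residual o k B A))
    (h : HL.Derivable (S.htree (Δ.plug (.form A))) T)
    (hX : ∀ l ≠ k, HL.Derivable (S.htree (X l)) (S.mu (B l))) :
    HL.Derivable (S.htree (Δ.plug (node o X))) T := by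
  obtain ⟨D, hD, s, hres, hnone, ⟨e₀, he₀, hlab₀⟩, hne⟩ := exists_mu_residual_eq o k B A
  have filling_derivable (d) : HL.Derivable (s.filling X (some d)) (D.lab d) := by
    obtain ⟨_ | l, hl⟩ := s.edge.surjective (some d)
    · rw [← hl, s.filling_none, ← Option.some.inj (he₀.symm.trans hl), hlab₀]
      exact .ax _
    · obtain ⟨d', hd', hlab⟩ := hne l (by rintro rfl; cases hnone.symm.trans hl)
      rw [← hl, s.filling_some, ← Option.some.inj (hd'.symm.trans hl), hlab]
      exact hX l (by rintro rfl; cases hnone.symm.trans hl)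
  have hlen (d) := s.length_ext_filling X (some d)
  have hnodup (d) := s.nodup_ext_filling X (some d)
  have hiso : ((D.fill (.div (S.mu A) D hD) rfl).replace Function.Embedding.some
      fun d => s.filling X (some d)).Iso (S.htree (node o X)) := by
    refine iso_htree_node s ?_ (images_fill_replace hlen hnodup) (fun b hb => ?_) fun l u => ?_
    · exact (nodup_ext_replace_iff hlen hnodup).2 s.nodup_ext
    · rw [he₀, Option.elim_some, ← he₀, s.filling_none]
      exact (images_handle (a := Formula.prim (symbol o)) hb).le
    · obtain rfl | hl := eq_or_ne l k
      · rw [hnone, Option.elim_none, hk, images_htree_form, hres]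
      · obtain ⟨d, hd, -⟩ := hne l hl
        rw [hd, Option.elim_some, ← hd, s.filling_some]
  obtain ⟨e, he, hiso'⟩ := exists_edge_plug hiso A Δ
  exact .iso hiso' (.divL _ e T _ D hD _ he h filling_derivable)

theorem derivable_residual {o : S.Op} {X : S.Child o → S.Db} {k : S.Child o}
    {B : S.Child o → S.Fm} {A : S.Fm} (hX : ∀ l ≠ k, X l = .form (B l))
    (h : HL.Derivable (S.htree (node o X)) (S.mu A)) :
    HL.Derivable (S.htree (X k)) (S.mu (residual o k B A)) := by
  obtain ⟨D, hD, s, hres, hnone, ⟨e₀, he₀, hlab₀⟩, hne⟩ := exists_mu_residual_eq o k B A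
  have hlen : (S.htree (X k)).ext.length = D.hole.length := by
    rw [length_ext_htree, ← Pattern.length_att_edge s k, hnone]
    rfl
  have hiso : ((D.fill (.div (S.mu A) D hD) rfl).replaceOne none (S.htree (X k))).Iso
      (S.htree (node o X)) := by
    refine iso_htree_node s ?_ (images_fill_replaceOne hlen (nodup_ext_htree _)) (fun b _ => ?_)
      fun l u => ?_
    · exact (nodup_ext_replace_iff (fun _ => hlen) fun _ => nodup_ext_htree _).2 s.nodup_ext
    · rw [he₀, Option.elim_some, hlab₀]
    · obtain rfl | hl := eq_or_ne l k
      · rw [hnone, Option.elim_none]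
      · obtain ⟨d, hd, hlab⟩ := hne l hl
        rw [hd, Option.elim_some, hX l hl, images_htree_form, hlab]
  exact hres ▸ .divR _ _ D hD hlen (.iso hiso.symm h)

theorem derivable_of_der {X : S.Db} {T : S.Fm} (h : Der X T) :
    HL.Derivable (S.htree X) (S.mu T) := by
  induction h with
  | ax T => exact .ax _
  | prodL Δ i A B T _ ih =>
    exact derivable_plug_prod (o := .inl i) (A := (![A, B] : Fin 2 → S.Fm)) ih
  | prodR i X Y A B _ _ ihX ihY =>
    exact derivable_node_prod (o := .inl i) (X := (![X, Y] : Fin 2 → S.Db))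
      (A := (![A, B] : Fin 2 → S.Fm)) (Fin.forall_fin_two.2 ⟨ihX, ihY⟩)
  | ldivL Δ i X A B T _ _ ih ihX =>
    exact derivable_plug_node (o := .inl i) (k := (1 : Fin 2)) (B := fun _ => B)
      (X := (![X, .form (.ldiv i B A)] : Fin 2 → S.Db)) rfl ih
      (Fin.forall_fin_two.2 ⟨fun _ => ihX, fun h => (h rfl).elim⟩)
  | ldivR i X A B _ ih =>
    exact derivable_residual (o := .inl i) (k := (1 : Fin 2)) (B := fun _ => B)
      (X := (![.form B, X] : Fin 2 → S.Db))
      (Fin.forall_fin_two.2 ⟨fun _ => rfl, fun h => (h rfl).elim⟩) ih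
  | rdivL Δ i X A B T _ _ ih ihX =>
    exact derivable_plug_node (o := .inl i) (k := (0 : Fin 2)) (B := fun _ => B)
      (X := (![.form (.rdiv i A B), X] : Fin 2 → S.Db)) rfl ih
      (Fin.forall_fin_two.2 ⟨fun h => (h rfl).elim, fun _ => ihX⟩)
  | rdivR i X A B _ ih =>
    exact derivable_residual (o := .inl i) (k := (0 : Fin 2)) (B := fun _ => B)
      (X := (![X, .form B] : Fin 2 → S.Db))
      (Fin.forall_fin_two.2 ⟨fun h => (h rfl).elim, fun _ => rfl⟩) ih
  | diaL Δ j A T _ ih => exact derivable_plug_prod (o := .inr j) (A := fun _ => A) ih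
  | diaR j X A _ ih =>
    exact derivable_node_prod (o := .inr j) (X := fun _ => X) (A := fun _ => A) fun _ => ih
  | boxL Δ j A T _ ih =>
    exact derivable_plug_node (o := .inr j) (k := ()) (B := fun _ => A)
      (X := fun _ => .form (.box j A)) rfl ih fun _ h => (h rfl).elim
  | boxR j X A _ ih =>
    exact derivable_residual (o := .inr j) (k := ()) (B := fun _ => A) (X := fun _ => X)
      (fun _ h => (h rfl).elim) ih
  | perm Δ i X Y T hi _ ih =>
    exact .iso (htree_plug_iso (htree_node_comp_iso (o := .inl i) hi
      (Equiv.swap (0 : Fin 2) (1 : Fin 2)) (![Y, X] : Fin 2 → S.Db)) Δ) ih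
  | assocL Δ i X Y Z T hi => exact hi.elim
  | assocR Δ i X Y Z T hi => exact hi.elim

end ModeSystem

theorem theorem1 {Pr : Type*} [HL.Ranked Pr] (S : ModeSystem Pr) :
    (∀ (X : S.Db) (T : S.Fm),
      NLM.Derivable S.C ∅ X T ↔ HL.Derivable (S.htree X) (S.mu T)) ∧
    (∀ (G : HL.Hypergraph (HL.Formula Pr)) (B : HL.Formula Pr),
      (∀ e, G.lab e ∈ S.labels) → B ∈ Set.range S.mu → HL.Derivable G B →
        ∃ (X : S.Db) (T : S.Fm),
          G.Iso (S.htree X) ∧ B = S.mu T ∧ NLM.Derivable S.C ∅ X T) := by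
  refine ⟨fun X T => ⟨ModeSystem.derivable_of_der, ModeSystem.der_of_derivable⟩, ?_⟩
  rintro G _ hG ⟨T, rfl⟩ h
  obtain ⟨X, hX, hT⟩ := ModeSystem.exists_iso_htree_of_derivable hG h
  exact ⟨X, T, hX, rfl, hT⟩
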